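/- Let $\alpha\in\{1,2,\infty\}$ and let $\|\cdot\|_\alpha$ be the $\ell_\alpha$-norm. For $X\in\mathbb{R}^{m\times n}$ let $\sigma(X)\in\mathbb{R}_+^{\min\{m,n\}}$ be the vector of its singular values. (i) Let $\delta,\eta\ge 0$, $Y\in\mathbb{R}^{m\times n}$, and let $Y=U\,\mathrm{diag}(\sigma)V^T$ be a (thin) singular value decomposition, where $\sigma\in\mathbb{R}_+^r$ and $U\in\mathbb{R}^{m\times r}$, $V\in\mathbb{R}^{n\times r}$ have orthonormal columns. Then the constrained matrix shrinkage problem $$\min\{\delta\|\sigma(X)\|_\alpha+\tfrac12\|X-Y\|_F^2:\ \|\sigma(X)\|_\alpha\le\eta,\ X\in\mathbb{R}^{m\times n}\}$$ has a unique optimal solution $X^*$, the constrained vector shrinkage problem $$\min\{\delta\|s\|_\alpha+\tfrac12\|s-\sigma\|_2^2:\ \|s\|_\alpha\le\eta,\ s\in\mathbb{R}^r\}$$ has a unique optimal solution $s^*$, and $X^*=U\,\mathrm{diag}(s^*)V^T$. The complexity claims refer to programs on a real random access machine: exact real arithmetic $+,-,\times,/$, square roots and comparisons, and elementary index operations, cost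 one step each; one program, with integer constants only, serves all input sizes. The computation of an SVD of an $m\times n$ matrix is a subroutine charged $\Theta(\min\{n^2m,m^2n\})$ steps. (ii) Suppose that a program without SVD calls solves every $p$-dimensional constrained vector shrinkage problem $\min\{\delta\|s\|_\alpha+\frac12\|s-q\|_2^2:\ \|s\|_\alpha\le\eta,\ s\in\mathbb{R}^p\}$ (with $q\in\mathbb{R}^p$, $\delta,\eta\ge0$) in at most $T(p)$ steps. Then there are a program and a constant $C$ such that the program computes $X^*$, for all $m,n\ge1$, $Y\in\mathbb{R}^{m\times n}$, $\delta,\eta\ge0$ and every choice of the SVD subroutine, in at most $C\,(\min\{n^2m,m^2n\}+T(r))$ steps, where $r$ is the number of columns of $U$ in the SVD of $Y$ that the subroutine returns. (iii) For $\alpha=1$ and $\alpha=\infty$ there is such a program for the vector problem with $T(p)=\mathcal{O}(p\ln p)$, and for $\alpha=2$ there is one with $T(p)=\mathcal{O}(p)$. -/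

import Mathlib

/-! ## The shrinkage problems -/

/-- The `ℓ_α` norm on `ℝ^p`. -/
noncomputable def ellNorm (α : ENNReal) {p : ℕ} (s : Fin p → ℝ) : ℝ :=
  ‖(WithLp.toLp α s : PiLp α fun _ : Fin p => ℝ)‖

/-- The vector `σ(X) ∈ ℝ^{min(m,n)}` of singular values of `X`, in decreasing order. -/
noncomputable def singVals {m n : ℕ} (X : Matrix (Fin m) (Fin n) ℝ) : Fin (min m n) → ℝ :=
  fun i => (Matrix.toEuclideanLin X).singularValues i

/-- `Y = U diag(σ) Vᵀ` is a (thin) singular value decomposition of `Y` with `r` columns: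
`U` and `V` have orthonormal columns and `σ ≥ 0`. -/
structure IsSVD {m n r : ℕ} (Y : Matrix (Fin m) (Fin n) ℝ)
    (U : Matrix (Fin m) (Fin r) ℝ) (σ : Fin r → ℝ) (V : Matrix (Fin n) (Fin r) ℝ) : Prop where
  left_orthonormal : U.transpose * U = 1
  right_orthonormal : V.transpose * V = 1
  nonneg : ∀ i, 0 ≤ σ i
  eq : Y = U * Matrix.diagonal σ * V.transpose

/-- The vector objective `δ ‖s‖_α + ½ ‖s - q‖₂²`. -/
noncomputable def vecObj (α : ENNReal) (δ : ℝ) {p : ℕ} (q s : Fin p → ℝ) : ℝ :=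
  δ * ellNorm α s + 1 / 2 * ∑ i, (s i - q i) ^ 2

/-- `s` is an optimal solution of `min {δ ‖s‖_α + ½ ‖s - q‖₂² : ‖s‖_α ≤ η}`. -/
def IsVecSol (α : ENNReal) (δ η : ℝ) {p : ℕ} (q s : Fin p → ℝ) : Prop :=
  ellNorm α s ≤ η ∧ ∀ s' : Fin p → ℝ, ellNorm α s' ≤ η → vecObj α δ q s ≤ vecObj α δ q s'

/-- The matrix objective `δ ‖σ(X)‖_α + ½ ‖X - Y‖_F²`. -/
noncomputable def matObj (α : ENNReal) (δ : ℝ) {m n : ℕ} (Y X : Matrix (Fin m) (Fin n) ℝ) : ℝ :=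
  δ * ellNorm α (singVals X) + 1 / 2 * ∑ i, ∑ j, (X i j - Y i j) ^ 2

/-- `X` is an optimal solution of `min {δ ‖σ(X)‖_α + ½ ‖X - Y‖_F² : ‖σ(X)‖_α ≤ η}`. -/
def IsMatSol (α : ENNReal) (δ η : ℝ) {m n : ℕ} (Y X : Matrix (Fin m) (Fin n) ℝ) : Prop :=
  ellNorm α (singVals X) ≤ η ∧
    ∀ X' : Matrix (Fin m) (Fin n) ℝ, ellNorm α (singVals X') ≤ η →
      matObj α δ Y X ≤ matObj α δ Y X'

/-! ## Real random access machine

A structured real RAM: natural number registers (used as counters and addresses), real registers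
and real arrays, with exact real arithmetic `+ - * /`, square root and comparison at unit cost.
A program is one finite text, used for all input sizes; its only constants are integers. -/

namespace RealRAM

/-- Memory: natural number registers, real registers, and real arrays (array `a`, cell `i`). -/
structure State where
  nat : ℕ → ℕ
  real : ℕ → ℝ
  arr : ℕ → ℕ → ℝ

/-- Address expressions (no multiplication). -/
inductive NExp where
  | const (k : ℕ)
  | reg (i : ℕ)
  | add (e f : NExp)
  | sub (e f : NExp)
  | half (e : NExp)

/-- Real expressions. -/
inductive RExp where
  | const (k : ℤ)
  | reg (i : ℕ)
  | get (a : ℕ) (i : NExp)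
  | add (e f : RExp)
  | sub (e f : RExp)
  | mul (e f : RExp)
  | div (e f : RExp)
  | sqrt (e : RExp)

/-- Comparisons. -/
inductive Cmp where
  | natLT (e f : NExp)
  | realLT (e f : RExp)

/-- Programs. `svd m n r a u s v` is the call of an SVD routine: it reads the dimensions from the
natural registers `m`, `n` and the matrix from array `a`, and writes the number of columns to the
natural register `r` and the three factors to the arrays `u`, `s`, `v`. -/
inductive Cmd where
  | skip
  | setNat (i : ℕ) (e : NExp)
  | setReal (i : ℕ) (e : RExp)
  | put (a : ℕ) (i : NExp) (e : RExp)
  | svd (m n r a u s v : ℕ)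
  | seq (c d : Cmd)
  | branch (b : Cmp) (c d : Cmd)
  | loop (b : Cmp) (c : Cmd)

/-- Value of an address expression (subtraction is truncated, `half` rounds down). -/
def NExp.val (st : State) : NExp → ℕ
  | .const k => k
  | .reg i => st.nat i
  | .add e f => e.val st + f.val st
  | .sub e f => e.val st - f.val st
  | .half e => e.val st / 2

/-- Number of elementary operations in the evaluation of an address expression. -/
def NExp.cost : NExp → ℕ
  | .const _ => 1
  | .reg _ => 1
  | .add e f => e.cost + f.cost + 1
  | .sub e f => e.cost + f.cost + 1
  | .half e => e.cost + 1

/-- Value of a real expression (`x / 0 = 0`, and the root of a negative number is `0`). -/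
noncomputable def RExp.val (st : State) : RExp → ℝ
  | .const k => (k : ℝ)
  | .reg i => st.real i
  | .get a i => st.arr a (i.val st)
  | .add e f => e.val st + f.val st
  | .sub e f => e.val st - f.val st
  | .mul e f => e.val st * f.val st
  | .div e f => e.val st / f.val st
  | .sqrt e => Real.sqrt (e.val st)

/-- Number of elementary operations in the evaluation of a real expression. -/
def RExp.cost : RExp → ℕ
  | .const _ => 1
  | .reg _ => 1
  | .get _ i => i.cost + 1
  | .add e f => e.cost + f.cost + 1
  | .sub e f => e.cost + f.cost + 1
  | .mul e f => e.cost + f.cost + 1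
  | .div e f => e.cost + f.cost + 1
  | .sqrt e => e.cost + 1

/-- Outcome of a comparison. -/
def Cmp.holds (st : State) : Cmp → Prop
  | .natLT e f => e.val st < f.val st
  | .realLT e f => e.val st < f.val st

/-- Number of elementary operations in a comparison. -/
def Cmp.cost : Cmp → ℕ
  | .natLT e f => e.cost + f.cost + 1
  | .realLT e f => e.cost + f.cost + 1

/-- The program uses elementary operations only (no call of the SVD routine). -/
def Cmd.Elementary : Cmd → Prop
  | .skip => True
  | .setNat _ _ => True
  | .setReal _ _ => True
  | .put _ _ _ => True
  | .svd _ _ _ _ _ _ _ => False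
  | .seq c d => c.Elementary ∧ d.Elementary
  | .branch _ c d => c.Elementary ∧ d.Elementary
  | .loop _ c => c.Elementary

/-- Three factors of an `m × n` matrix, with `r` columns. -/
structure Factors (m n : ℕ) where
  r : ℕ
  U : Matrix (Fin m) (Fin r) ℝ
  σ : Fin r → ℝ
  V : Matrix (Fin n) (Fin r) ℝ

/-- The input-output behaviour of a factorization routine. -/
abbrev Routine := ∀ m n : ℕ, Matrix (Fin m) (Fin n) ℝ → Factors m n

/-- The routine returns an SVD of every matrix. -/
def Routine.Correct (O : Routine) : Prop :=
  ∀ (m n : ℕ) (Y : Matrix (Fin m) (Fin n) ℝ), IsSVD Y (O m n Y).U (O m n Y).σ (O m n Y).V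

/-- The array `f` holds the vector `v` in its first `p` cells. -/
def HoldsVec (f : ℕ → ℝ) {p : ℕ} (v : Fin p → ℝ) : Prop :=
  ∀ i : Fin p, f i = v i

/-- The array `f` holds the matrix `M` in its first `m * n` cells, row by row. -/
def HoldsMat (f : ℕ → ℝ) {m n : ℕ} (M : Matrix (Fin m) (Fin n) ℝ) : Prop :=
  ∀ (i : Fin m) (j : Fin n), f (i * n + j) = M i j

/-- The `m × n` matrix held by the array `f`. -/
def readMat (f : ℕ → ℝ) (m n : ℕ) : Matrix (Fin m) (Fin n) ℝ :=
  Matrix.of fun i j => f (i * n + j)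

/-- The array `f` after the vector `v` has been written to its first cells. -/
def writeVec (f : ℕ → ℝ) {p : ℕ} (v : Fin p → ℝ) : ℕ → ℝ :=
  fun t => if h : t < p then v ⟨t, h⟩ else f t

/-- The array `f` after the matrix `M` has been written to its first cells, row by row. -/
def writeMat (f : ℕ → ℝ) {m n : ℕ} (M : Matrix (Fin m) (Fin n) ℝ) : ℕ → ℝ :=
  writeVec f fun t : Fin (m * n) => M (finProdFinEquiv.symm t).1 (finProdFinEquiv.symm t).2

/-- Write a natural register. -/
def State.setNat (st : State) (i k : ℕ) : State :=
  { st with nat := Function.update st.nat i k }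

/-- Write a real register. -/
def State.setReal (st : State) (i : ℕ) (x : ℝ) : State :=
  { st with real := Function.update st.real i x }

/-- Replace an array. -/
def State.setArr (st : State) (a : ℕ) (f : ℕ → ℝ) : State :=
  { st with arr := Function.update st.arr a f }

/-- Write the factors `F` to the natural register `r` and to the arrays `u`, `s`, `v`. -/
def State.setFactors (st : State) {m n : ℕ} (F : Factors m n) (r u s v : ℕ) : State :=
  (((st.setNat r F.r).setArr u (writeMat (st.arr u) F.U)).setArr s
    (writeVec (st.arr s) F.σ)).setArr v (writeMat (st.arr v) F.V)

/-- `Exec O c st t st'`: with the routine `O`, the program `c` started in the state `st` halts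
after `t` steps in the state `st'`. A call of the routine on an `m × n` matrix is charged
`min(n²m, m²n)` steps, plus one. -/
inductive Exec (O : Routine) : Cmd → State → ℕ → State → Prop where
  | skip (st : State) : Exec O .skip st 1 st
  | setNat (st : State) (i : ℕ) (e : NExp) :
      Exec O (.setNat i e) st (e.cost + 1) (st.setNat i (e.val st))
  | setReal (st : State) (i : ℕ) (e : RExp) :
      Exec O (.setReal i e) st (e.cost + 1) (st.setReal i (e.val st))
  | put (st : State) (a : ℕ) (i : NExp) (e : RExp) :
      Exec O (.put a i e) st (i.cost + e.cost + 1)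
        (st.setArr a (Function.update (st.arr a) (i.val st) (e.val st)))
  | svd (st : State) (m n r a u s v : ℕ) :
      Exec O (.svd m n r a u s v) st
        (min (st.nat n ^ 2 * st.nat m) (st.nat m ^ 2 * st.nat n) + 1)
        (st.setFactors (O (st.nat m) (st.nat n) (readMat (st.arr a) (st.nat m) (st.nat n)))
          r u s v)
  | seq {c d : Cmd} {st st₁ st₂ : State} {t₁ t₂ : ℕ} :
      Exec O c st t₁ st₁ → Exec O d st₁ t₂ st₂ → Exec O (.seq c d) st (t₁ + t₂) st₂
  | branchTrue {b : Cmp} {c d : Cmd} {st st₁ : State} {t : ℕ} :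
      b.holds st → Exec O c st t st₁ → Exec O (.branch b c d) st (b.cost + t) st₁
  | branchFalse {b : Cmp} {c d : Cmd} {st st₁ : State} {t : ℕ} :
      ¬ b.holds st → Exec O d st t st₁ → Exec O (.branch b c d) st (b.cost + t) st₁
  | loopTrue {b : Cmp} {c : Cmd} {st st₁ st₂ : State} {t₁ t₂ : ℕ} :
      b.holds st → Exec O c st t₁ st₁ → Exec O (.loop b c) st₁ t₂ st₂ →
        Exec O (.loop b c) st (b.cost + t₁ + t₂) st₂
  | loopFalse {b : Cmp} {c : Cmd} {st : State} :
      ¬ b.holds st → Exec O (.loop b c) st b.cost st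

/-- The elementary program `P` solves the constrained vector shrinkage problem with norm `‖·‖_α`,
on every instance of dimension `p` within `T p` steps.
Input: `p` in natural register `0`, `δ` and `η` in real registers `0` and `1`, the vector in
array `0`; everything else in memory is arbitrary. Output: the optimal solution in array `1`. -/
def SolvesVec (α : ENNReal) (P : Cmd) (T : ℕ → ℕ) : Prop :=
  P.Elementary ∧
    ∀ (O : Routine) (p : ℕ) (q : Fin p → ℝ) (δ η : ℝ), 0 ≤ δ → 0 ≤ η →
      ∀ st : State, st.nat 0 = p → st.real 0 = δ → st.real 1 = η → HoldsVec (st.arr 0) q →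
        ∃ (t : ℕ) (st' : State) (s : Fin p → ℝ),
          Exec O P st t st' ∧ t ≤ T p ∧ HoldsVec (st'.arr 1) s ∧ IsVecSol α δ η q s

/-- With every correct SVD routine, the program `Q` solves the constrained matrix shrinkage
problem with norm `‖σ(·)‖_α`, on every instance `Y` of size `m × n`, `m, n ≥ 1`, within `B m n r`
steps, where `r` is the number of columns of the SVD of `Y` that the routine computes.
Input: `m`, `n` in natural registers `0` and `1`, `δ` and `η` in real registers `0` and `1`, the
matrix `Y` in array `0`; everything else in memory is arbitrary.
Output: the optimal solution in array `1`. -/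
def SolvesMat (α : ENNReal) (Q : Cmd) (B : ℕ → ℕ → ℕ → ℕ) : Prop :=
  ∀ O : Routine, O.Correct →
    ∀ (m n : ℕ) (Y : Matrix (Fin m) (Fin n) ℝ) (δ η : ℝ), 1 ≤ m → 1 ≤ n → 0 ≤ δ → 0 ≤ η →
      ∀ st : State, st.nat 0 = m → st.nat 1 = n → st.real 0 = δ → st.real 1 = η →
        HoldsMat (st.arr 0) Y →
        ∃ (t : ℕ) (st' : State) (X : Matrix (Fin m) (Fin n) ℝ),
          Exec O Q st t st' ∧ t ≤ B m n (O m n Y).r ∧ HoldsMat (st'.arr 1) X ∧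
            IsMatSol α δ η Y X

end RealRAM

/-!
The coefficients of `X` on the rank-one matrices `uᵢ vᵢᵀ` of a singular value decomposition of `Y`
are the diagonal of `Uᵀ X V`. This diagonal is bounded by a doubly substochastic matrix applied to
the singular values of `X`, so its norm is at most that of the singular values, by convexity of
`x ↦ xᵖ`. By Pythagoras the Frobenius term splits into the distance of the coefficients from `σ` and
the distance of `X` from its projection. Hence the solutions of the matrix problem are exactly the
matrices `U diag(s) Vᵀ` with `s` a solution of the vector problem.

A vector `s` solves the vector problem as soon as the dual norm of `q - s` certifies it. For `α = 2`
a multiple of `q` has a certificate. For `α = 1` and `α = ∞` one thresholds or clips `q` at the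
level `max δ l` or `min η l` respectively, where `l` is the level over which the total excess of the
`|qᵢ|` is `η` or `δ` respectively, and zero if the excess over zero is already smaller. The level is
found by extracting the maxima one by one from a tournament tree, in `O(log p)` steps each.
-/

open scoped Matrix

/-! ### Norms of singular values -/

section Substochastic

variable {ι κ : Type*} [Fintype ι] [Fintype κ]

/-- A doubly substochastic matrix: nonnegative entries, row and column sums at most one. -/
structure IsDoublySubstochastic (D : Matrix ι κ ℝ) : Prop where
  nonneg : ∀ i j, 0 ≤ D i j
  row_sum_le_one : ∀ i, ∑ j, D i j ≤ 1
  col_sum_le_one : ∀ j, ∑ i, D i j ≤ 1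

theorem IsDoublySubstochastic.mulVec_rpow_le {D : Matrix ι κ ℝ} (hD : IsDoublySubstochastic D)
    {p : ℝ} (hp : 1 ≤ p) {x : κ → ℝ} (hx : ∀ j, 0 ≤ x j) (i : ι) :
    (∑ j, D i j * x j) ^ p ≤ ∑ j, D i j * x j ^ p := by
  have hp₀ : 0 < p := by positivity
  have hterm (j : κ) : 0 ≤ D i j * x j := mul_nonneg (hD.nonneg i j) (hx j)
  have hpow : 0 ≤ ∑ j, D i j * x j ^ p :=
    Finset.sum_nonneg fun j _ => mul_nonneg (hD.nonneg i j) (Real.rpow_nonneg (hx j) p)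
  have hholder : ∑ j, D i j * x j ≤ (∑ j, D i j * x j ^ p) ^ p⁻¹ :=
    (Real.inner_le_weight_mul_Lp_of_nonneg _ hp _ _ (hD.nonneg i) hx).trans <|
      mul_le_of_le_one_left (Real.rpow_nonneg hpow _) <|
        Real.rpow_le_one (Finset.sum_nonneg fun j _ => hD.nonneg i j) (hD.row_sum_le_one i)
          (sub_nonneg.2 (inv_le_one_of_one_le₀ hp))
  calc (∑ j, D i j * x j) ^ p ≤ ((∑ j, D i j * x j ^ p) ^ p⁻¹) ^ p :=
        Real.rpow_le_rpow (Finset.sum_nonneg fun j _ => hterm j) hholder hp₀.le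
    _ = ∑ j, D i j * x j ^ p := Real.rpow_inv_rpow hpow hp₀.ne'

theorem IsDoublySubstochastic.sum_mulVec_le {D : Matrix ι κ ℝ} (hD : IsDoublySubstochastic D)
    {y : κ → ℝ} (hy : ∀ j, 0 ≤ y j) : ∑ i, ∑ j, D i j * y j ≤ ∑ j, y j := by
  rw [Finset.sum_comm]
  refine Finset.sum_le_sum fun j _ => ?_
  rw [← Finset.sum_mul]
  exact mul_le_of_le_one_left (hy j) (hD.col_sum_le_one j)

theorem IsDoublySubstochastic.norm_toLp_le {α : ENNReal} (hα : 1 ≤ α) {D : Matrix ι κ ℝ}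
    (hD : IsDoublySubstochastic D) {s : ι → ℝ} {τ : κ → ℝ}
    (hs : ∀ i, |s i| ≤ ∑ j, D i j * |τ j|) : ‖WithLp.toLp α s‖ ≤ ‖WithLp.toLp α τ‖ := by
  rcases eq_or_ne α ⊤ with rfl | hα_top
  · rw [PiLp.norm_toLp, PiLp.norm_toLp, pi_norm_le_iff_of_nonneg (norm_nonneg τ)]
    intro i
    calc ‖s i‖ ≤ ∑ j, D i j * ‖τ‖ := (hs i).trans <| Finset.sum_le_sum fun j _ =>
          mul_le_mul_of_nonneg_left (norm_le_pi_norm τ j) (hD.nonneg i j)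
      _ = (∑ j, D i j) * ‖τ‖ := (Finset.sum_mul ..).symm
      _ ≤ ‖τ‖ := mul_le_of_le_one_left (norm_nonneg τ) (hD.row_sum_le_one i)
  · have hp : 1 ≤ α.toReal := by simpa using ENNReal.toReal_mono hα_top hα
    have hp₀ : 0 < α.toReal := by positivity
    rw [PiLp.norm_eq_sum hp₀, PiLp.norm_eq_sum hp₀]
    refine Real.rpow_le_rpow (Finset.sum_nonneg fun i _ => by positivity) ?_ (by positivity)
    calc ∑ i, |s i| ^ α.toReal ≤ ∑ i, (∑ j, D i j * |τ j|) ^ α.toReal :=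
          Finset.sum_le_sum fun i _ => Real.rpow_le_rpow (abs_nonneg _) (hs i) hp₀.le
      _ ≤ ∑ i, ∑ j, D i j * |τ j| ^ α.toReal :=
          Finset.sum_le_sum fun i _ => hD.mulVec_rpow_le hp (fun j => abs_nonneg _) i
      _ ≤ ∑ j, |τ j| ^ α.toReal := hD.sum_mulVec_le fun j => by positivity

end Substochastic

section OrthonormalColumns

variable {m n ι κ : Type*} [Fintype m] [Fintype n] [Fintype κ]

theorem dotProduct_self_transpose_mulVec_le [DecidableEq κ] {A : Matrix m κ ℝ} (hA : Aᵀ * A = 1)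
    (x : m → ℝ) : (Aᵀ *ᵥ x) ⬝ᵥ (Aᵀ *ᵥ x) ≤ x ⬝ᵥ x := by
  set y := Aᵀ *ᵥ x
  have hxy : x ⬝ᵥ A *ᵥ y = y ⬝ᵥ y := by rw [Matrix.dotProduct_mulVec, ← Matrix.mulVec_transpose]
  have hyy : A *ᵥ y ⬝ᵥ A *ᵥ y = y ⬝ᵥ y := by
    rw [Matrix.dotProduct_mulVec, ← Matrix.mulVec_transpose, Matrix.mulVec_mulVec, hA,
      Matrix.one_mulVec]
  have hres : 0 ≤ (x - A *ᵥ y) ⬝ᵥ (x - A *ᵥ y) := Finset.sum_nonneg fun i _ => mul_self_nonneg _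
  rw [sub_dotProduct, dotProduct_sub, dotProduct_sub, dotProduct_comm (A *ᵥ y) x, hxy, hyy] at hres
  linarith

theorem sum_sq_row_transpose_mul_le_one [DecidableEq ι] [DecidableEq κ] {U : Matrix m ι ℝ}
    {A : Matrix m κ ℝ} (hU : Uᵀ * U = 1) (hA : Aᵀ * A = 1) (i : ι) :
    ∑ j, (Uᵀ * A) i j ^ 2 ≤ 1 := by
  calc ∑ j, (Uᵀ * A) i j ^ 2 = (Aᵀ *ᵥ Uᵀ i) ⬝ᵥ (Aᵀ *ᵥ Uᵀ i) := by
        simp only [Matrix.mul_apply, Matrix.mulVec, dotProduct, Matrix.transpose_apply, mul_comm,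
          sq]
    _ ≤ Uᵀ i ⬝ᵥ Uᵀ i := dotProduct_self_transpose_mulVec_le hA _
    _ = 1 := (congrFun₂ hU i i).trans (Matrix.one_apply_eq i)

theorem isDoublySubstochastic_sq_transpose_mul [Fintype ι] [DecidableEq ι] [DecidableEq κ]
    {U : Matrix m ι ℝ} {A : Matrix m κ ℝ} {V : Matrix n ι ℝ} {B : Matrix n κ ℝ}
    (hU : Uᵀ * U = 1) (hA : Aᵀ * A = 1) (hV : Vᵀ * V = 1) (hB : Bᵀ * B = 1) :
    IsDoublySubstochastic
      (Matrix.of fun i j => ((Uᵀ * A) i j ^ 2 + (Vᵀ * B) i j ^ 2) / 2 : Matrix ι κ ℝ) where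
  nonneg i j := by simp only [Matrix.of_apply]; positivity
  row_sum_le_one i := by
    simp only [Matrix.of_apply, ← Finset.sum_div, Finset.sum_add_distrib]
    linarith [sum_sq_row_transpose_mul_le_one hU hA i, sum_sq_row_transpose_mul_le_one hV hB i]
  col_sum_le_one j := by
    have hUA (i : ι) : (Uᵀ * A) i j = (Aᵀ * U) j i := by
      rw [← Matrix.transpose_apply (Aᵀ * U), Matrix.transpose_mul, Matrix.transpose_transpose]
    have hVB (i : ι) : (Vᵀ * B) i j = (Bᵀ * V) j i := by
      rw [← Matrix.transpose_apply (Bᵀ * V), Matrix.transpose_mul, Matrix.transpose_transpose]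
    simp only [Matrix.of_apply, ← Finset.sum_div, Finset.sum_add_distrib, hUA, hVB]
    linarith [sum_sq_row_transpose_mul_le_one hA hU j, sum_sq_row_transpose_mul_le_one hB hV j]

end OrthonormalColumns

section DiagCoeff

variable {m n ι κ : Type*} [Fintype m] [Fintype n]

/-- The diagonal of `Uᵀ X V`: the coefficients of `X` on the rank-one matrices `uᵢ vᵢᵀ` formed from
the columns of `U` and `V`. -/
def diagCoeff (U : Matrix m ι ℝ) (V : Matrix n ι ℝ) (X : Matrix m n ℝ) : ι → ℝ :=
  fun i => (Uᵀ * X * V) i i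

theorem diagCoeff_mul_diagonal_mul [Fintype κ] [DecidableEq κ] (U : Matrix m ι ℝ)
    (V : Matrix n ι ℝ) (A : Matrix m κ ℝ) (B : Matrix n κ ℝ) (τ : κ → ℝ) (i : ι) :
    diagCoeff U V (A * Matrix.diagonal τ * Bᵀ) i = ∑ j, (Uᵀ * A) i j * (Vᵀ * B) i j * τ j := by
  have hassoc :
      Uᵀ * (A * Matrix.diagonal τ * Bᵀ) * V = Uᵀ * A * Matrix.diagonal τ * (Vᵀ * B)ᵀ := by
    simp only [Matrix.mul_assoc, Matrix.transpose_mul, Matrix.transpose_transpose]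
  rw [diagCoeff, hassoc, Matrix.mul_apply]
  simp only [Matrix.mul_diagonal, Matrix.transpose_apply, mul_right_comm]

theorem diagCoeff_self [Fintype ι] [DecidableEq ι] {U : Matrix m ι ℝ} {V : Matrix n ι ℝ}
    (hU : Uᵀ * U = 1) (hV : Vᵀ * V = 1) (s : ι → ℝ) :
    diagCoeff U V (U * Matrix.diagonal s * Vᵀ) = s := by
  funext i
  simp [diagCoeff_mul_diagonal_mul, hU, hV, Matrix.one_apply]

theorem abs_diagCoeff_le [Fintype κ] [DecidableEq κ] (U : Matrix m ι ℝ) (V : Matrix n ι ℝ)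
    (A : Matrix m κ ℝ) (B : Matrix n κ ℝ) (τ : κ → ℝ) (i : ι) :
    |diagCoeff U V (A * Matrix.diagonal τ * Bᵀ) i| ≤
      ∑ j, ((Uᵀ * A) i j ^ 2 + (Vᵀ * B) i j ^ 2) / 2 * |τ j| := by
  rw [diagCoeff_mul_diagonal_mul]
  refine (Finset.abs_sum_le_sum_abs _ _).trans (Finset.sum_le_sum fun j _ => ?_)
  rw [abs_mul]
  refine mul_le_mul_of_nonneg_right (abs_le.2 ⟨?_, ?_⟩) (abs_nonneg _)
  · linarith [sq_nonneg ((Uᵀ * A) i j + (Vᵀ * B) i j), add_sq ((Uᵀ * A) i j) ((Vᵀ * B) i j)]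
  · linarith [two_mul_le_add_sq ((Uᵀ * A) i j) ((Vᵀ * B) i j)]

end DiagCoeff

theorem ellNorm_diagCoeff_le {α : ENNReal} (hα : 1 ≤ α) {m n r k : ℕ}
    {U : Matrix (Fin m) (Fin r) ℝ} {V : Matrix (Fin n) (Fin r) ℝ}
    {A : Matrix (Fin m) (Fin k) ℝ} {B : Matrix (Fin n) (Fin k) ℝ} (hU : Uᵀ * U = 1)
    (hV : Vᵀ * V = 1) (hA : Aᵀ * A = 1) (hB : Bᵀ * B = 1) (τ : Fin k → ℝ) :
    ellNorm α (diagCoeff U V (A * Matrix.diagonal τ * Bᵀ)) ≤ ellNorm α τ :=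
  (isDoublySubstochastic_sq_transpose_mul hU hA hV hB).norm_toLp_le hα
    (abs_diagCoeff_le U V A B τ)

section SingularValueDecomposition

variable {E F : Type*} [NormedAddCommGroup E] [InnerProductSpace ℝ E] [FiniteDimensional ℝ E]
  [NormedAddCommGroup F] [InnerProductSpace ℝ F] [FiniteDimensional ℝ F] (T : E →ₗ[ℝ] F)

theorem inner_map_eigenvectorBasis {n : ℕ} (hn : Module.finrank ℝ E = n) (a b : Fin n) :
    inner ℝ (T (T.isSymmetric_adjoint_comp_self.eigenvectorBasis hn a))
        (T (T.isSymmetric_adjoint_comp_self.eigenvectorBasis hn b)) =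
      if a = b then T.singularValues a ^ 2 else 0 := by
  have heigen := T.isSymmetric_adjoint_comp_self.apply_eigenvectorBasis hn b
  rw [LinearMap.comp_apply] at heigen
  rw [← LinearMap.adjoint_inner_right, heigen, inner_smul_right, OrthonormalBasis.inner_eq_ite]
  split_ifs with hab
  · rw [hab, T.sq_singularValues_fin hn b, mul_one, RCLike.ofReal_real_eq_id, id]
  · rw [mul_zero]

theorem singularValues_eq_zero_of_min_finrank_le {j : ℕ}
    (hj : min (Module.finrank ℝ F) (Module.finrank ℝ E) ≤ j) : T.singularValues j = 0 :=
  T.singularValues_eq_zero_iff_le_finrank_range.2 <|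
    (le_min (Submodule.finrank_le _) (LinearMap.finrank_range_le T)).trans hj

theorem exists_orthonormalBasis_map_eq_singularValues_smul {m n : ℕ}
    (hm : Module.finrank ℝ F = m) (hn : Module.finrank ℝ E = n) :
    ∃ (v : OrthonormalBasis (Fin n) ℝ E) (u : OrthonormalBasis (Fin m) ℝ F),
      (∀ i : Fin (min m n), T (v (i.castLE (min_le_right m n))) =
          T.singularValues i • u (i.castLE (min_le_left m n))) ∧
        ∀ j : Fin n, m ≤ j → T (v j) = 0 := by
  set v := T.isSymmetric_adjoint_comp_self.eigenvectorBasis hn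
  have hinner (a b : Fin n) : inner ℝ (T (v a)) (T (v b)) =
      if a = b then T.singularValues a ^ 2 else 0 := inner_map_eigenvectorBasis T hn a b
  have hzero (a : Fin n) (ha : T.singularValues a = 0) : T (v a) = 0 := by
    simpa [ha] using hinner a a
  have hvanish {j : ℕ} (hj : min m n ≤ j) : T.singularValues j = 0 :=
    singularValues_eq_zero_of_min_finrank_le T (by rwa [hm, hn])
  let w (i : Fin m) : F :=
    if h : (i : ℕ) < n then (T.singularValues i)⁻¹ • T (v ⟨i, h⟩) else 0
  have hw_of_lt {i : Fin m} (h : (i : ℕ) < n) :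
      w i = (T.singularValues i)⁻¹ • T (v ⟨i, h⟩) := dif_pos h
  have hw : Orthonormal ℝ ({i : Fin m | T.singularValues i ≠ 0}.domRestrict w) := by
    rw [orthonormal_iff_ite]
    rintro ⟨i, hi⟩ ⟨j, hj⟩
    have hin : (i : ℕ) < n := by_contra fun h => hi (hvanish (min_le_of_right_le (not_lt.1 h)))
    have hjn : (j : ℕ) < n := by_contra fun h => hj (hvanish (min_le_of_right_le (not_lt.1 h)))
    simp only [Set.domRestrict_apply, hw_of_lt hin, hw_of_lt hjn, real_inner_smul_left,
      real_inner_smul_right, hinner, Subtype.mk.injEq, Fin.mk.injEq, Fin.val_inj]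
    split_ifs with hij
    · subst hij
      rw [sq, inv_mul_cancel_left₀ hi, inv_mul_cancel₀ hi]
    · simp only [mul_zero]
  obtain ⟨u, hu⟩ := hw.exists_orthonormalBasis_extension_of_card_eq (by simpa using hm)
  refine ⟨v, u, fun i => ?_, fun j hj => hzero j (hvanish (min_le_of_left_le hj))⟩
  by_cases hi : T.singularValues i = 0
  · rw [hi, zero_smul, hzero _ hi]
  · rw [hu _ hi, hw_of_lt (i.2.trans_le (min_le_right m n))]
    exact (smul_inv_smul₀ hi _).symm

theorem transpose_mul_self_of_orthonormal {m κ : Type*} [Fintype m] [DecidableEq κ]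
    {u : κ → EuclideanSpace ℝ m} (hu : Orthonormal ℝ u) :
    (Matrix.of fun i j => u j i)ᵀ * (Matrix.of fun i j => u j i) = 1 := by
  ext a b
  rw [Matrix.one_apply, ← orthonormal_iff_ite.1 hu a b, PiLp.inner_apply, Matrix.mul_apply]
  exact Finset.sum_congr rfl fun i _ => mul_comm _ _

theorem exists_isSVD_singVals {m n : ℕ} (X : Matrix (Fin m) (Fin n) ℝ) :
    ∃ A B, IsSVD X A (singVals X) B := by
  set T := Matrix.toEuclideanLin X
  obtain ⟨v, u, hvu, hv⟩ := exists_orthonormalBasis_map_eq_singularValues_smul T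
    finrank_euclideanSpace_fin finrank_euclideanSpace_fin
  have hcast_left : Function.Injective (Fin.castLE (min_le_left m n)) := Fin.castLE_injective _
  have hcast : Function.Injective (Fin.castLE (min_le_right m n)) := Fin.castLE_injective _
  let V : Matrix (Fin n) (Fin n) ℝ := Matrix.of fun i j => v j i
  have hV : V * Vᵀ = 1 := mul_eq_one_comm.1 (transpose_mul_self_of_orthonormal v.orthonormal)
  have hX (i l) : X i l = ∑ j, T (v j) i * v j l := by
    rw [← X.mul_one, ← hV, ← Matrix.mul_assoc, Matrix.mul_apply]
    simp only [T, Matrix.mul_apply, Matrix.toLpLin_apply, Matrix.mulVec, dotProduct, V,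
      Matrix.of_apply, Matrix.transpose_apply]
  refine ⟨_, _, transpose_mul_self_of_orthonormal (u.orthonormal.comp _ hcast_left),
    transpose_mul_self_of_orthonormal (v.orthonormal.comp _ hcast),
    fun i => T.singularValues_nonneg i, ?_⟩
  ext i l
  rw [hX, Matrix.mul_apply]
  refine (Fintype.sum_of_injective _ hcast _ _ (fun j hj => ?_) fun j => ?_).symm
  · have hmj : m ≤ j := by_contra fun h => hj ⟨⟨j, lt_min (not_le.1 h) j.2⟩, rfl⟩
    rw [hv j hmj, PiLp.zero_apply, zero_mul]
  · rw [hvu, Matrix.mul_diagonal, PiLp.smul_apply, smul_eq_mul, mul_comm (T.singularValues j)]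
    rfl

end SingularValueDecomposition

section SingularValueNorm

variable {α : ENNReal} {m n r : ℕ} {U : Matrix (Fin m) (Fin r) ℝ} {V : Matrix (Fin n) (Fin r) ℝ}

theorem ellNorm_diagCoeff_le_singVals (hα : 1 ≤ α) (hU : Uᵀ * U = 1) (hV : Vᵀ * V = 1)
    (X : Matrix (Fin m) (Fin n) ℝ) : ellNorm α (diagCoeff U V X) ≤ ellNorm α (singVals X) := by
  obtain ⟨A, B, hX⟩ := exists_isSVD_singVals X
  calc ellNorm α (diagCoeff U V X)
      = ellNorm α (diagCoeff U V (A * Matrix.diagonal (singVals X) * Bᵀ)) := by rw [← hX.eq]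
    _ ≤ ellNorm α (singVals X) :=
        ellNorm_diagCoeff_le hα hU hV hX.left_orthonormal hX.right_orthonormal _

theorem ellNorm_singVals_mul_diagonal_mul (hα : 1 ≤ α) (hU : Uᵀ * U = 1) (hV : Vᵀ * V = 1)
    (s : Fin r → ℝ) : ellNorm α (singVals (U * Matrix.diagonal s * Vᵀ)) = ellNorm α s := by
  refine le_antisymm ?_ ?_
  · obtain ⟨A, B, hX⟩ := exists_isSVD_singVals (U * Matrix.diagonal s * Vᵀ)
    calc ellNorm α (singVals (U * Matrix.diagonal s * Vᵀ))
        = ellNorm α (diagCoeff A B (U * Matrix.diagonal s * Vᵀ)) := by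
          conv_rhs => rw [hX.eq, diagCoeff_self hX.left_orthonormal hX.right_orthonormal]
      _ ≤ ellNorm α s := ellNorm_diagCoeff_le hα hX.left_orthonormal hX.right_orthonormal hU hV s
  · calc ellNorm α s = ellNorm α (diagCoeff U V (U * Matrix.diagonal s * Vᵀ)) := by
          rw [diagCoeff_self hU hV]
      _ ≤ ellNorm α (singVals (U * Matrix.diagonal s * Vᵀ)) :=
          ellNorm_diagCoeff_le_singVals hα hU hV _

end SingularValueNorm

/-! ### Reduction of the matrix problem to the vector problem -/

section Frobenius

variable {m n ι : Type*} [Fintype m] [Fintype n]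

/-- The squared Frobenius norm. -/
def frobSq (X : Matrix m n ℝ) : ℝ := ∑ i, ∑ j, X i j ^ 2

theorem frobSq_eq_trace (X : Matrix m n ℝ) : frobSq X = (Xᵀ * X).trace := by
  simp only [frobSq, Matrix.trace, Matrix.diag, Matrix.mul_apply, Matrix.transpose_apply, sq]
  exact Finset.sum_comm

theorem frobSq_nonneg (X : Matrix m n ℝ) : 0 ≤ frobSq X :=
  Finset.sum_nonneg fun _ _ => Finset.sum_nonneg fun _ _ => sq_nonneg _

theorem eq_zero_of_frobSq_nonpos {X : Matrix m n ℝ} (hX : frobSq X ≤ 0) : X = 0 := by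
  rw [frobSq_eq_trace, ← Matrix.conjTranspose_eq_transpose_of_trivial] at hX
  refine Matrix.trace_conjTranspose_mul_self_eq_zero_iff.1 (hX.antisymm ?_)
  rw [Matrix.conjTranspose_eq_transpose_of_trivial, ← frobSq_eq_trace]
  exact frobSq_nonneg X

variable [Fintype ι] [DecidableEq ι] {U : Matrix m ι ℝ} {V : Matrix n ι ℝ}

theorem frobSq_sub_mul_diagonal_mul (hU : Uᵀ * U = 1) (hV : Vᵀ * V = 1) (X : Matrix m n ℝ)
    (t : ι → ℝ) : frobSq (X - U * Matrix.diagonal t * Vᵀ) =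
      frobSq X - 2 * ∑ i, t i * diagCoeff U V X i + ∑ i, t i ^ 2 := by
  set Y := U * Matrix.diagonal t * Vᵀ with hY
  have hYX : (Yᵀ * X).trace = ∑ i, t i * diagCoeff U V X i := by
    have hassoc : Yᵀ * X = V * (Matrix.diagonal t * (Uᵀ * X)) := by simp [hY, Matrix.mul_assoc]
    rw [hassoc, Matrix.trace_mul_comm, Matrix.mul_assoc]
    simp [Matrix.trace, Matrix.diagonal_mul, diagCoeff]
  have hXY : (Xᵀ * Y).trace = ∑ i, t i * diagCoeff U V X i := by
    rw [← hYX, ← Matrix.trace_transpose, Matrix.transpose_mul, Matrix.transpose_transpose]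
  have hYY : (Yᵀ * Y).trace = ∑ i, t i ^ 2 := by
    have hassoc : Yᵀ * Y = V * (Matrix.diagonal t * (Uᵀ * U) * Matrix.diagonal t * Vᵀ) := by
      simp [hY, Matrix.mul_assoc]
    rw [hassoc, Matrix.trace_mul_comm, Matrix.mul_assoc, hU, hV]
    simp [Matrix.trace, sq]
  rw [frobSq_eq_trace, frobSq_eq_trace, Matrix.transpose_sub, Matrix.sub_mul, Matrix.mul_sub,
    Matrix.mul_sub, Matrix.trace_sub, Matrix.trace_sub, Matrix.trace_sub, hYX, hXY, hYY]
  ring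

theorem frobSq_sub_eq_add_sum_sq (hU : Uᵀ * U = 1) (hV : Vᵀ * V = 1) (X : Matrix m n ℝ)
    (σ : ι → ℝ) : frobSq (X - U * Matrix.diagonal σ * Vᵀ) =
      frobSq (X - U * Matrix.diagonal (diagCoeff U V X) * Vᵀ) +
        ∑ i, (diagCoeff U V X i - σ i) ^ 2 := by
  have hexpand : ∑ i, (diagCoeff U V X i - σ i) ^ 2 =
      ∑ i, diagCoeff U V X i * diagCoeff U V X i - 2 * ∑ i, σ i * diagCoeff U V X i +
        ∑ i, σ i ^ 2 := by
    rw [Finset.mul_sum, ← Finset.sum_sub_distrib, ← Finset.sum_add_distrib]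
    exact Finset.sum_congr rfl fun i _ => by ring
  rw [frobSq_sub_mul_diagonal_mul hU hV, frobSq_sub_mul_diagonal_mul hU hV, hexpand]
  simp only [sq]
  ring

end Frobenius

section VectorProblem

variable {α : ENNReal} {δ η : ℝ} {p : ℕ} {q s t : Fin p → ℝ}

theorem ellNorm_midpoint_le (hα : 1 ≤ α) (s t : Fin p → ℝ) :
    ellNorm α (fun i => (s i + t i) / 2) ≤ (ellNorm α s + ellNorm α t) / 2 := by
  have : Fact (1 ≤ α) := ⟨hα⟩
  have hmid : WithLp.toLp α (fun i => (s i + t i) / 2) =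
      (2⁻¹ : ℝ) • (WithLp.toLp α s + WithLp.toLp α t) := by
    ext i
    exact div_eq_inv_mul _ _
  rw [ellNorm, hmid, norm_smul, Real.norm_of_nonneg (by norm_num), inv_mul_eq_div]
  exact div_le_div_of_nonneg_right (norm_add_le _ _) zero_le_two

theorem IsVecSol.unique (hα : 1 ≤ α) (hδ : 0 ≤ δ) (hs : IsVecSol α δ η q s)
    (ht : IsVecSol α δ η q t) : s = t := by
  have hnorm := ellNorm_midpoint_le hα s t
  have hfeas : ellNorm α (fun i => (s i + t i) / 2) ≤ η := by linarith [hs.1, ht.1]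
  have hs_le := hs.2 _ hfeas
  have ht_le := ht.2 _ hfeas
  have hparallelogram : ∑ i, ((s i + t i) / 2 - q i) ^ 2 =
      1 / 2 * ∑ i, (s i - q i) ^ 2 + 1 / 2 * ∑ i, (t i - q i) ^ 2 -
        1 / 4 * ∑ i, (s i - t i) ^ 2 := by
    rw [Finset.mul_sum, Finset.mul_sum, Finset.mul_sum, ← Finset.sum_add_distrib,
      ← Finset.sum_sub_distrib]
    exact Finset.sum_congr rfl fun i _ => by ring
  simp only [vecObj] at hs_le ht_le
  have hdist : ∑ i, (s i - t i) ^ 2 = 0 :=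
    le_antisymm (by linarith [mul_le_mul_of_nonneg_left hnorm hδ])
      (Finset.sum_nonneg fun _ _ => sq_nonneg _)
  rw [Finset.sum_eq_zero_iff_of_nonneg fun _ _ => sq_nonneg _] at hdist
  exact funext fun i => sub_eq_zero.1 (sq_eq_zero_iff.1 (hdist i (Finset.mem_univ i)))

theorem exists_isVecSol (hα : 1 ≤ α) (δ : ℝ) (hη : 0 ≤ η) (q : Fin p → ℝ) :
    ∃ s, IsVecSol α δ η q s := by
  have : Fact (1 ≤ α) := ⟨hα⟩
  obtain ⟨x, hx, hmin⟩ :=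
    (isCompact_closedBall (0 : PiLp α fun _ : Fin p => ℝ) η).exists_isMinOn
      ⟨0, Metric.mem_closedBall_self hη⟩
      (f := fun x => δ * ‖x‖ + 1 / 2 * ∑ i, (x i - q i) ^ 2) (by fun_prop)
  exact ⟨x.ofLp, mem_closedBall_zero_iff.1 hx, fun s' hs' =>
    hmin (a := WithLp.toLp α s') (mem_closedBall_zero_iff.2 hs')⟩

end VectorProblem

section MatrixProblem

variable {α : ENNReal} {δ η : ℝ} {m n r : ℕ} {Y X : Matrix (Fin m) (Fin n) ℝ}
  {U : Matrix (Fin m) (Fin r) ℝ} {V : Matrix (Fin n) (Fin r) ℝ} {σ s : Fin r → ℝ}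

theorem matObj_mul_diagonal_mul (hα : 1 ≤ α) (h : IsSVD Y U σ V) (s : Fin r → ℝ) :
    matObj α δ Y (U * Matrix.diagonal s * Vᵀ) = vecObj α δ σ s := by
  have hfrob : frobSq (U * Matrix.diagonal s * Vᵀ - Y) = ∑ i, (s i - σ i) ^ 2 := by
    rw [h.eq, frobSq_sub_eq_add_sum_sq h.left_orthonormal h.right_orthonormal,
      diagCoeff_self h.left_orthonormal h.right_orthonormal, sub_self, frobSq_eq_trace,
      Matrix.mul_zero, Matrix.trace_zero, zero_add]
  rw [vecObj, ← hfrob,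
    ← ellNorm_singVals_mul_diagonal_mul hα h.left_orthonormal h.right_orthonormal]
  rfl

theorem vecObj_diagCoeff_add_frobSq_le (hα : 1 ≤ α) (hδ : 0 ≤ δ) (h : IsSVD Y U σ V)
    (X : Matrix (Fin m) (Fin n) ℝ) : vecObj α δ σ (diagCoeff U V X) +
      1 / 2 * frobSq (X - U * Matrix.diagonal (diagCoeff U V X) * Vᵀ) ≤ matObj α δ Y X := by
  have hnorm := ellNorm_diagCoeff_le_singVals hα h.left_orthonormal h.right_orthonormal X
  have hfrob := frobSq_sub_eq_add_sum_sq h.left_orthonormal h.right_orthonormal X σ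
  have hmat : matObj α δ Y X = δ * ellNorm α (singVals X) + 1 / 2 * frobSq (X - Y) := rfl
  rw [hmat, h.eq, hfrob, vecObj]
  linarith [mul_le_mul_of_nonneg_left hnorm hδ]

theorem IsVecSol.isMatSol (hα : 1 ≤ α) (hδ : 0 ≤ δ) (h : IsSVD Y U σ V)
    (hs : IsVecSol α δ η σ s) : IsMatSol α δ η Y (U * Matrix.diagonal s * Vᵀ) := by
  have hnorm := ellNorm_singVals_mul_diagonal_mul hα h.left_orthonormal h.right_orthonormal s
  refine ⟨hnorm.trans_le hs.1, fun X hX => ?_⟩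
  have hvec := hs.2 (diagCoeff U V X)
    ((ellNorm_diagCoeff_le_singVals hα h.left_orthonormal h.right_orthonormal X).trans hX)
  rw [matObj_mul_diagonal_mul hα h]
  linarith [vecObj_diagCoeff_add_frobSq_le hα hδ h X,
    frobSq_nonneg (X - U * Matrix.diagonal (diagCoeff U V X) * Vᵀ)]

theorem IsMatSol.eq_mul_diagonal_mul (hα : 1 ≤ α) (hδ : 0 ≤ δ) (h : IsSVD Y U σ V)
    (hs : IsVecSol α δ η σ s) (hX : IsMatSol α δ η Y X) : X = U * Matrix.diagonal s * Vᵀ := by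
  have hfeas : ellNorm α (diagCoeff U V X) ≤ η :=
    (ellNorm_diagCoeff_le_singVals hα h.left_orthonormal h.right_orthonormal X).trans hX.1
  have hX_le := hX.2 _ (hs.isMatSol hα hδ h).1
  rw [matObj_mul_diagonal_mul hα h] at hX_le
  have hlower := vecObj_diagCoeff_add_frobSq_le hα hδ h X
  have hres := frobSq_nonneg (X - U * Matrix.diagonal (diagCoeff U V X) * Vᵀ)
  have hdiag : diagCoeff U V X = s := by
    refine IsVecSol.unique hα hδ ⟨hfeas, fun s' hs' => ?_⟩ hs
    linarith [hs.2 s' hs']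
  rw [hdiag] at hlower
  exact sub_eq_zero.1 (eq_zero_of_frobSq_nonpos (by linarith))

end MatrixProblem

/-! ### Solutions of the vector problem -/

section DualCertificate

variable {α : ENNReal} {δ η D : ℝ} {p : ℕ} {q s : Fin p → ℝ}

theorem ellNorm_nonneg (hα : 1 ≤ α) (s : Fin p → ℝ) : 0 ≤ ellNorm α s := by
  have : Fact (1 ≤ α) := ⟨hα⟩
  exact norm_nonneg _

/-- `D` plays the role of the dual norm of `q - s`. -/
theorem isVecSol_of_dual (hα : 1 ≤ α) (hfeas : ellNorm α s ≤ η)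
    (hdual : ∀ s', ∑ i, (q i - s i) * s' i ≤ D * ellNorm α s')
    (halign : D * ellNorm α s ≤ ∑ i, (q i - s i) * s i)
    (hcompat : ∀ x, 0 ≤ x → x ≤ η → (D - δ) * (x - ellNorm α s) ≤ 0) : IsVecSol α δ η q s := by
  refine ⟨hfeas, fun s' hs' => ?_⟩
  have hexpand : ∑ i, (s' i - q i) ^ 2 = ∑ i, (s i - q i) ^ 2 - 2 * ∑ i, (q i - s i) * s' i +
      2 * ∑ i, (q i - s i) * s i + ∑ i, (s' i - s i) ^ 2 := by
    rw [Finset.mul_sum, Finset.mul_sum, ← Finset.sum_sub_distrib, ← Finset.sum_add_distrib,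
      ← Finset.sum_add_distrib]
    exact Finset.sum_congr rfl fun i _ => by ring
  have hdist : 0 ≤ ∑ i, (s' i - s i) ^ 2 := Finset.sum_nonneg fun _ _ => sq_nonneg _
  simp only [vecObj]
  linarith [hcompat _ (ellNorm_nonneg hα s') hs', hdual s']

end DualCertificate

section EuclideanShrinkage

variable {δ η : ℝ} {p : ℕ}

theorem ellNorm_two (s : Fin p → ℝ) : ellNorm 2 s = √(∑ i, s i ^ 2) := by
  simp only [ellNorm, PiLp.norm_eq_of_L2, Real.norm_eq_abs, sq_abs]

theorem isVecSol_two_of_mul {c : ℝ} (q : Fin p → ℝ) (hc₀ : 0 ≤ c) (hc₁ : c ≤ 1)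
    (hfeas : c * ellNorm 2 q ≤ η)
    (hcompat : ∀ y, 0 ≤ y → y ≤ η →
      (ellNorm 2 q - c * ellNorm 2 q - δ) * (y - c * ellNorm 2 q) ≤ 0) :
    IsVecSol 2 δ η q fun i => c * q i := by
  have hnorm : ellNorm 2 (fun i => c * q i) = c * ellNorm 2 q := by
    simp only [ellNorm_two, mul_pow, ← Finset.mul_sum]
    rw [Real.sqrt_mul (sq_nonneg c), Real.sqrt_sq hc₀]
  have hfactor (s : Fin p → ℝ) : ∑ i, (q i - c * q i) * s i = (1 - c) * ∑ i, q i * s i := by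
    rw [Finset.mul_sum]
    exact Finset.sum_congr rfl fun i _ => by ring
  have hsq : ∑ i, q i * (c * q i) = c * ellNorm 2 q ^ 2 := by
    rw [ellNorm_two, Real.sq_sqrt (Finset.sum_nonneg fun _ _ => sq_nonneg _), Finset.mul_sum]
    exact Finset.sum_congr rfl fun i _ => by ring
  refine isVecSol_of_dual (D := (1 - c) * ellNorm 2 q) one_le_two (hnorm.trans_le hfeas)
    (fun s => ?_) ?_ fun y hy₀ hyη => ?_
  · rw [hfactor, mul_assoc, ellNorm_two, ellNorm_two]
    exact mul_le_mul_of_nonneg_left (Real.sum_mul_le_sqrt_mul_sqrt _ _ _) (sub_nonneg.2 hc₁)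
  · rw [hnorm, hfactor, hsq]
    exact le_of_eq (by ring)
  · rw [hnorm, one_sub_mul]
    exact hcompat y hy₀ hyη

theorem sub_mul_sub_min_max_nonpos {x y η : ℝ} (hy₀ : 0 ≤ y) (hyη : y ≤ η) :
    (x - min (max 0 x) η) * (y - min (max 0 x) η) ≤ 0 := by
  rcases le_total (max 0 x) η with h | h
  · rw [min_eq_left h]
    rcases le_total 0 x with hx | hx
    · rw [max_eq_right hx, sub_self, zero_mul]
    · rw [max_eq_left hx, sub_zero, sub_zero]
      exact mul_nonpos_of_nonpos_of_nonneg hx hy₀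
  · rw [min_eq_right h]
    rcases le_max_iff.1 h with hη | hx
    · rw [show y = η by linarith, sub_self, mul_zero]
    · exact mul_nonpos_of_nonneg_of_nonpos (sub_nonneg.2 hx) (sub_nonpos.2 hyη)

/-- For `q = 0` the factor is `0 / 0 = 0`, and the solution is still correct. -/
theorem isVecSol_two (hδ : 0 ≤ δ) (hη : 0 ≤ η) (q : Fin p → ℝ) :
    IsVecSol 2 δ η q fun i => min (max 0 (ellNorm 2 q - δ)) η / ellNorm 2 q * q i := by
  set N := ellNorm 2 q
  set x := min (max 0 (N - δ)) η
  have hN : 0 ≤ N := ellNorm_nonneg one_le_two q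
  have hx : 0 ≤ x := le_min (le_max_left _ _) hη
  have hxN : x ≤ N := (min_le_left _ _).trans (max_le hN (sub_le_self N hδ))
  have hmul : x / N * N = x := div_mul_cancel_of_imp fun h => le_antisymm (h ▸ hxN) hx
  refine isVecSol_two_of_mul q (div_nonneg hx hN) (div_le_one_of_le₀ hxN hN)
    (hmul.trans_le (min_le_right _ _)) fun y hy₀ hyη => ?_
  rw [hmul, sub_right_comm]
  exact sub_mul_sub_min_max_nonpos hy₀ hyη

end EuclideanShrinkage

section Clip

variable {l : ℝ}

/-- The projection of `x` to the interval `[-l, l]`. -/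
noncomputable def clip (l x : ℝ) : ℝ := max (-l) (min x l)

theorem abs_clip_le (hl : 0 ≤ l) (x : ℝ) : |clip l x| ≤ l :=
  abs_le.2 ⟨le_max_left _ _, max_le (by linarith) (min_le_right _ _)⟩

theorem clip_of_abs_le {x : ℝ} (hx : |x| ≤ l) : clip l x = x := by
  rw [clip, min_eq_left (abs_le.1 hx).2, max_eq_right (abs_le.1 hx).1]

theorem clip_of_lt_abs (hl : 0 ≤ l) {x : ℝ} (hx : l < |x|) :
    l < x ∧ clip l x = l ∨ x < -l ∧ clip l x = -l := by
  rcases lt_abs.1 hx with h | h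
  · exact .inl ⟨h, by rw [clip, min_eq_right h.le, max_eq_right (by linarith)]⟩
  · exact .inr ⟨by linarith, by rw [clip, min_eq_left (by linarith), max_eq_left (by linarith)]⟩

theorem abs_clip_of_lt_abs (hl : 0 ≤ l) {x : ℝ} (hx : l < |x|) : |clip l x| = l := by
  rcases clip_of_lt_abs hl hx with ⟨-, h⟩ | ⟨-, h⟩
  · rw [h, abs_of_nonneg hl]
  · rw [h, abs_neg, abs_of_nonneg hl]

theorem abs_sub_clip (hl : 0 ≤ l) (x : ℝ) : |x - clip l x| = max (|x| - l) 0 := by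
  rcases le_or_gt |x| l with hx | hx
  · rw [clip_of_abs_le hx, sub_self, abs_zero, max_eq_right (sub_nonpos.2 hx)]
  · rw [max_eq_left (sub_nonneg.2 hx.le)]
    rcases clip_of_lt_abs hl hx with ⟨hlx, h⟩ | ⟨hlx, h⟩
    · rw [h, abs_of_nonneg (by linarith : 0 ≤ x - l), abs_of_nonneg (by linarith : 0 ≤ x)]
    · rw [h, abs_of_nonpos (by linarith : x - -l ≤ 0), abs_of_nonpos (by linarith : x ≤ 0)]
      ring

theorem sub_clip_mul_clip (hl : 0 ≤ l) (x : ℝ) :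
    (x - clip l x) * clip l x = l * |x - clip l x| := by
  rcases le_or_gt |x| l with hx | hx
  · rw [clip_of_abs_le hx, sub_self, zero_mul, abs_zero, mul_zero]
  · rcases clip_of_lt_abs hl hx with ⟨hlx, h⟩ | ⟨hlx, h⟩
    · rw [h, abs_of_nonneg (by linarith : 0 ≤ x - l), mul_comm]
    · rw [h, abs_of_nonpos (by linarith : x - -l ≤ 0)]
      ring

end Clip

section Excess

variable {ι : Type*} {s : Finset ι} {a : ι → ℝ} {c l : ℝ}

/-- The total amount by which the entries of `a` at the indices in `s` exceed the level `l`. -/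
def excess (s : Finset ι) (a : ι → ℝ) (l : ℝ) : ℝ := ∑ i ∈ s, max (a i - l) 0

theorem excess_nonneg (s : Finset ι) (a : ι → ℝ) (l : ℝ) : 0 ≤ excess s a l :=
  Finset.sum_nonneg fun _ _ => le_max_right _ _

theorem excess_antitone (s : Finset ι) (a : ι → ℝ) : Antitone (excess s a) := fun _ _ h =>
  Finset.sum_le_sum fun _ _ => max_le_max_right _ (sub_le_sub_left h _)

theorem excess_of_forall_le (h : ∀ i ∈ s, l ≤ a i) : excess s a l = ∑ i ∈ s, a i - s.card * l := by
  rw [excess, Finset.sum_congr rfl fun i hi => max_eq_left (sub_nonneg.2 (h i hi)),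
    Finset.sum_sub_distrib, Finset.sum_const, nsmul_eq_mul]

theorem sum_sub_card_mul_le_excess (s : Finset ι) (a : ι → ℝ) (l : ℝ) :
    ∑ i ∈ s, a i - s.card * l ≤ excess s a l := by
  rw [excess, ← nsmul_eq_mul, ← Finset.sum_const, ← Finset.sum_sub_distrib]
  exact Finset.sum_le_sum fun _ _ => le_max_left _ _

/-- `l` is the level at which `a` has the excess `c` on `s`, cut off at zero: `l = 0` if the excess
at level zero is already at most `c`. -/
structure IsLevel (s : Finset ι) (a : ι → ℝ) (c l : ℝ) : Prop where
  nonneg : 0 ≤ l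
  excess_le : excess s a l ≤ c
  excess_eq : 0 < l → excess s a l = c

theorem isLevel_empty (a : ι → ℝ) (hc : 0 ≤ c) : IsLevel ∅ a c 0 :=
  ⟨le_rfl, hc, fun h => (lt_irrefl _ h).elim⟩

theorem IsLevel.insert [DecidableEq ι] {i : ι} (h : IsLevel s a c l) (hi : i ∉ s)
    (hmin : ∀ j ∈ s, a i ≤ a j) :
    IsLevel (insert i s) a c (max l ((∑ j ∈ insert i s, a j - c) / (insert i s).card)) := by
  have hexcess (x : ℝ) : excess (Insert.insert i s) a x = max (a i - x) 0 + excess s a x :=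
    Finset.sum_insert hi
  have hsum := sum_sub_card_mul_le_excess (Insert.insert i s) a
  have hcard : (0 : ℝ) < (Insert.insert i s).card := Nat.cast_pos.2 (by simp)
  set m := (∑ j ∈ Insert.insert i s, a j - c) / (Insert.insert i s).card with hm
  rcases le_or_gt (a i) l with hil | hil
  · have hsame : excess (Insert.insert i s) a l = excess s a l := by
      rw [hexcess, max_eq_right (sub_nonpos.2 hil), zero_add]
    rw [max_eq_left ((div_le_iff₀' hcard).2 (by linarith [hsum l, h.excess_le]))]
    exact ⟨h.nonneg, hsame.trans_le h.excess_le, fun hl => hsame.trans (h.excess_eq hl)⟩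
  have hmi : m ≤ a i := by
    have hsame : excess (Insert.insert i s) a (a i) = excess s a (a i) := by
      rw [hexcess, sub_self, max_self, zero_add]
    exact (div_le_iff₀' hcard).2 (by
      linarith [hsum (a i), excess_antitone s a hil.le, h.excess_le])
  have hlinear {x : ℝ} (hx : x ≤ a i) : excess (Insert.insert i s) a x =
      ∑ j ∈ Insert.insert i s, a j - (Insert.insert i s).card * x :=
    excess_of_forall_le (Finset.forall_mem_insert _ _ _ |>.2
      ⟨hx, fun j hj => hx.trans (hmin j hj)⟩)
  have hexcess_m : excess (Insert.insert i s) a m = c := by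
    rw [hlinear hmi, hm, mul_div_cancel₀ _ hcard.ne', sub_sub_cancel]
  refine ⟨h.nonneg.trans (le_max_left _ _),
    (excess_antitone _ a (le_max_right l m)).trans_eq hexcess_m, fun hpos => ?_⟩
  rcases le_total l m with hlm | hlm
  · rw [max_eq_right hlm, hexcess_m]
  · rw [max_eq_left hlm] at hpos ⊢
    refine le_antisymm ((excess_antitone _ a hlm).trans_eq hexcess_m) ?_
    rw [hexcess, h.excess_eq hpos]
    exact le_add_of_nonneg_left (le_max_right _ _)

end Excess

section ShrinkageByLevels

variable {δ η l : ℝ} {p : ℕ} {q : Fin p → ℝ}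

theorem ellNorm_one (s : Fin p → ℝ) : ellNorm 1 s = ∑ i, |s i| := by
  simp only [ellNorm, PiLp.norm_eq_of_L1, Real.norm_eq_abs]

theorem ellNorm_top (s : Fin p → ℝ) : ellNorm ⊤ s = ‖s‖ :=
  PiLp.norm_toLp s

theorem sum_abs_sub_clip (hl : 0 ≤ l) (q : Fin p → ℝ) :
    ∑ i, |q i - clip l (q i)| = excess Finset.univ (fun i => |q i|) l :=
  Finset.sum_congr rfl fun i _ => abs_sub_clip hl (q i)

theorem isVecSol_one (hδ : 0 ≤ δ) (hl : IsLevel Finset.univ (fun i => |q i|) η l) :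
    IsVecSol 1 δ η q fun i => q i - clip (max l δ) (q i) := by
  have hk : 0 ≤ max l δ := hδ.trans (le_max_right _ _)
  have hnorm : ellNorm 1 (fun i => q i - clip (max l δ) (q i)) =
      excess Finset.univ (fun i => |q i|) (max l δ) := by
    rw [ellNorm_one, sum_abs_sub_clip hk]
  refine isVecSol_of_dual (D := max l δ) le_rfl ?_ (fun s' => ?_) ?_ fun x _ hxη => ?_
  · exact hnorm.trans_le ((excess_antitone _ _ (le_max_left _ _)).trans hl.excess_le)
  · rw [ellNorm_one, Finset.mul_sum]
    refine Finset.sum_le_sum fun i _ => (le_abs_self _).trans ?_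
    rw [sub_sub_cancel, abs_mul]
    exact mul_le_mul_of_nonneg_right (abs_clip_le hk _) (abs_nonneg _)
  · rw [ellNorm_one, Finset.mul_sum]
    refine (Finset.sum_congr rfl fun i _ => ?_).le
    rw [← sub_clip_mul_clip hk, sub_sub_cancel, mul_comm]
  · rw [hnorm]
    rcases le_or_gt l δ with h | h
    · rw [max_eq_right h, sub_self, zero_mul]
    · rw [max_eq_left h.le, hl.excess_eq (hδ.trans_lt h)]
      exact mul_nonpos_of_nonneg_of_nonpos (sub_nonneg.2 h.le) (sub_nonpos.2 hxη)

theorem ellNorm_top_clip_le (hl : 0 ≤ l) (q : Fin p → ℝ) :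
    ellNorm ⊤ (fun i => clip l (q i)) ≤ l := by
  rw [ellNorm_top, pi_norm_le_iff_of_nonneg hl]
  exact fun i => abs_clip_le hl _

theorem ellNorm_top_clip_eq (hl : 0 ≤ l) (hq : 0 < excess Finset.univ (fun i => |q i|) l) :
    ellNorm ⊤ (fun i => clip l (q i)) = l := by
  obtain ⟨i, -, hi⟩ := Finset.exists_ne_zero_of_sum_ne_zero hq.ne'
  have hlt : l < |q i| := by
    by_contra! h
    exact hi (max_eq_right (sub_nonpos.2 h))
  refine (ellNorm_top_clip_le hl q).antisymm ?_
  rw [ellNorm_top]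
  exact (abs_clip_of_lt_abs hl hlt).symm.trans_le (norm_le_pi_norm (fun i => clip l (q i)) i)

theorem excess_sub_mul_sub_ellNorm_top_clip_nonpos (hδ : 0 ≤ δ)
    (hl : IsLevel Finset.univ (fun i => |q i|) δ l) {x : ℝ} (hx : 0 ≤ x) (hxη : x ≤ η) :
    (excess Finset.univ (fun i => |q i|) (min l η) - δ) *
      (x - ellNorm ⊤ fun i => clip (min l η) (q i)) ≤ 0 := by
  have hη : 0 ≤ η := hx.trans hxη
  rcases le_or_gt l η with h | h
  · rw [min_eq_left h]
    rcases hl.nonneg.eq_or_lt with rfl | hpos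
    · rw [(ellNorm_top_clip_le le_rfl q).antisymm (ellNorm_nonneg le_top _), sub_zero]
      exact mul_nonpos_of_nonpos_of_nonneg (sub_nonpos.2 hl.excess_le) hx
    · rw [hl.excess_eq hpos, sub_self, zero_mul]
  · rw [min_eq_right h.le]
    have hexcess : δ ≤ excess Finset.univ (fun i => |q i|) η :=
      (hl.excess_eq (hη.trans_lt h)).symm.trans_le (excess_antitone _ _ h.le)
    rcases hexcess.eq_or_lt with heq | hlt
    · rw [← heq, sub_self, zero_mul]
    · rw [ellNorm_top_clip_eq hη (hδ.trans_lt hlt)]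
      exact mul_nonpos_of_nonneg_of_nonpos (sub_nonneg.2 hexcess) (sub_nonpos.2 hxη)

theorem isVecSol_top (hδ : 0 ≤ δ) (hη : 0 ≤ η) (hl : IsLevel Finset.univ (fun i => |q i|) δ l) :
    IsVecSol ⊤ δ η q fun i => clip (min l η) (q i) := by
  have ht : 0 ≤ min l η := le_min hl.nonneg hη
  refine isVecSol_of_dual (D := excess Finset.univ (fun i => |q i|) (min l η)) le_top
    ((ellNorm_top_clip_le ht q).trans (min_le_right _ _)) (fun s' => ?_) ?_
    fun x hx hxη => excess_sub_mul_sub_ellNorm_top_clip_nonpos hδ hl hx hxη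
  · rw [ellNorm_top, ← sum_abs_sub_clip ht, Finset.sum_mul]
    refine Finset.sum_le_sum fun i _ => (le_abs_self _).trans ?_
    rw [abs_mul]
    exact mul_le_mul_of_nonneg_left (norm_le_pi_norm s' i) (abs_nonneg _)
  · refine (mul_le_mul_of_nonneg_left (ellNorm_top_clip_le ht q) (excess_nonneg _ _ _)).trans ?_
    rw [← sum_abs_sub_clip ht, mul_comm, Finset.mul_sum]
    exact (Finset.sum_congr rfl fun i _ => (sub_clip_mul_clip ht _).symm).le

end ShrinkageByLevels

namespace RealRAM

/-! ### Program logic for the random access machine -/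

@[simp] theorem State.setNat_nat (st : State) (i k j : ℕ) :
    (st.setNat i k).nat j = if j = i then k else st.nat j := Function.update_apply _ _ _ _

@[simp] theorem State.setNat_real (st : State) (i k : ℕ) : (st.setNat i k).real = st.real := rfl

@[simp] theorem State.setNat_arr (st : State) (i k : ℕ) : (st.setNat i k).arr = st.arr := rfl

@[simp] theorem State.setReal_real (st : State) (i : ℕ) (x : ℝ) (j : ℕ) :
    (st.setReal i x).real j = if j = i then x else st.real j := Function.update_apply _ _ _ _

@[simp] theorem State.setReal_arr (st : State) (i : ℕ) (x : ℝ) :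
    (st.setReal i x).arr = st.arr := rfl

@[simp] theorem State.setArr_nat (st : State) (a : ℕ) (f : ℕ → ℝ) :
    (st.setArr a f).nat = st.nat := rfl

@[simp] theorem State.setArr_real (st : State) (a : ℕ) (f : ℕ → ℝ) :
    (st.setArr a f).real = st.real := rfl

@[simp] theorem State.setArr_arr (st : State) (a : ℕ) (f : ℕ → ℝ) (b : ℕ) :
    (st.setArr a f).arr b = if b = a then f else st.arr b := Function.update_apply _ _ _ _

/-- The natural registers that a program may write. -/
def Cmd.natWrites : Cmd → List ℕ
  | .setNat i _ => [i]
  | .svd _ _ r _ _ _ _ => [r]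
  | .seq c d => c.natWrites ++ d.natWrites
  | .branch _ c d => c.natWrites ++ d.natWrites
  | .loop _ c => c.natWrites
  | _ => []

/-- The real registers that a program may write. -/
def Cmd.realWrites : Cmd → List ℕ
  | .setReal i _ => [i]
  | .seq c d => c.realWrites ++ d.realWrites
  | .branch _ c d => c.realWrites ++ d.realWrites
  | .loop _ c => c.realWrites
  | _ => []

/-- The arrays that a program may write. -/
def Cmd.arrWrites : Cmd → List ℕ
  | .put a _ _ => [a]
  | .svd _ _ _ _ u s v => [u, s, v]
  | .seq c d => c.arrWrites ++ d.arrWrites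
  | .branch _ c d => c.arrWrites ++ d.arrWrites
  | .loop _ c => c.arrWrites
  | _ => []

/-- The states agree on the part of memory that the program cannot write. -/
structure Frame (c : Cmd) (st st' : State) : Prop where
  nat : ∀ i ∉ c.natWrites, st'.nat i = st.nat i
  real : ∀ i ∉ c.realWrites, st'.real i = st.real i
  arr : ∀ a ∉ c.arrWrites, st'.arr a = st.arr a

/-- Started in `st`, the program halts within `T` steps in a state with the property `Q`. -/
def Runs (O : Routine) (c : Cmd) (st : State) (T : ℕ) (Q : State → Prop) : Prop :=
  ∃ t st', Exec O c st t st' ∧ t ≤ T ∧ Q st'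

variable {O : Routine} {c d : Cmd} {b : Cmp} {st st₁ st₂ st₃ : State} {t T T' T₁ T₂ : ℕ}
  {Q R : State → Prop}

namespace Frame

theorem refl (c : Cmd) (st : State) : Frame c st st :=
  ⟨fun _ _ => rfl, fun _ _ => rfl, fun _ _ => rfl⟩

theorem trans (h : Frame c st₁ st₂) (h' : Frame c st₂ st₃) : Frame c st₁ st₃ :=
  ⟨fun i hi => (h'.nat i hi).trans (h.nat i hi), fun i hi => (h'.real i hi).trans (h.real i hi),
    fun i hi => (h'.arr i hi).trans (h.arr i hi)⟩

theorem mono (h : Frame c st₁ st₂) (hn : c.natWrites ⊆ d.natWrites)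
    (hr : c.realWrites ⊆ d.realWrites) (ha : c.arrWrites ⊆ d.arrWrites) : Frame d st₁ st₂ :=
  ⟨fun i hi => h.nat i fun h' => hi (hn h'), fun i hi => h.real i fun h' => hi (hr h'),
    fun i hi => h.arr i fun h' => hi (ha h')⟩

theorem seq (h : Frame c st₁ st₂) (h' : Frame d st₂ st₃) : Frame (.seq c d) st₁ st₃ :=
  (h.mono (List.subset_append_left _ _) (List.subset_append_left _ _)
    (List.subset_append_left _ _)).trans
  (h'.mono (List.subset_append_right _ _) (List.subset_append_right _ _)
    (List.subset_append_right _ _))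

theorem branch_left (h : Frame c st₁ st₂) : Frame (.branch b c d) st₁ st₂ :=
  h.mono (List.subset_append_left _ _) (List.subset_append_left _ _) (List.subset_append_left _ _)

theorem branch_right (h : Frame d st₁ st₂) : Frame (.branch b c d) st₁ st₂ :=
  h.mono (List.subset_append_right _ _) (List.subset_append_right _ _)
    (List.subset_append_right _ _)

theorem loop (h : Frame c st₁ st₂) : Frame (.loop b c) st₁ st₂ :=
  ⟨h.nat, h.real, h.arr⟩

end Frame

theorem Exec.frame (h : Exec O c st₁ t st₂) : Frame c st₁ st₂ := by
  induction h with
  | skip st => exact Frame.refl _ _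
  | setNat st i e =>
    exact ⟨fun j hj => Function.update_of_ne (List.ne_of_not_mem_cons hj) _ _, fun _ _ => rfl,
      fun _ _ => rfl⟩
  | setReal st i e =>
    exact ⟨fun _ _ => rfl, fun j hj => Function.update_of_ne (List.ne_of_not_mem_cons hj) _ _,
      fun _ _ => rfl⟩
  | put st a i e =>
    exact ⟨fun _ _ => rfl, fun _ _ => rfl,
      fun j hj => Function.update_of_ne (List.ne_of_not_mem_cons hj) _ _⟩
  | svd st m n r a u s v =>
    exact ⟨fun j hj => by simp_all [Cmd.natWrites, State.setFactors], fun _ _ => rfl,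
      fun j hj => by simp_all [Cmd.arrWrites, State.setFactors]⟩
  | seq _ _ ih₁ ih₂ => exact ih₁.seq ih₂
  | branchTrue _ _ ih => exact ih.branch_left
  | branchFalse _ _ ih => exact ih.branch_right
  | loopTrue _ _ _ ih₁ ih₂ => exact ih₁.loop.trans ih₂
  | loopFalse _ => exact Frame.refl _ _

namespace Runs

theorem of_le (h : Runs O c st T Q) (hT : T ≤ T') : Runs O c st T' Q :=
  let ⟨t, st', hexec, ht, hQ⟩ := h
  ⟨t, st', hexec, ht.trans hT, hQ⟩

theorem imp (h : Runs O c st T Q) (hQR : ∀ st', Frame c st st' → Q st' → R st') :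
    Runs O c st T R :=
  let ⟨t, st', hexec, ht, hQ⟩ := h
  ⟨t, st', hexec, ht, hQR st' hexec.frame hQ⟩

theorem setNat {i : ℕ} {e : NExp} (h : Q (st.setNat i (e.val st))) :
    Runs O (.setNat i e) st (e.cost + 1) Q := ⟨_, _, .setNat _ _ _, le_rfl, h⟩

theorem setReal {i : ℕ} {e : RExp} (h : Q (st.setReal i (e.val st))) :
    Runs O (.setReal i e) st (e.cost + 1) Q := ⟨_, _, .setReal _ _ _, le_rfl, h⟩

theorem put {a : ℕ} {i : NExp} {e : RExp}
    (h : Q (st.setArr a (Function.update (st.arr a) (i.val st) (e.val st)))) :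
    Runs O (.put a i e) st (i.cost + e.cost + 1) Q := ⟨_, _, .put _ _ _ _, le_rfl, h⟩

theorem seq (h : Runs O c st T₁ R) (h' : ∀ st₁, Frame c st st₁ → R st₁ → Runs O d st₁ T₂ Q) :
    Runs O (.seq c d) st (T₁ + T₂) Q :=
  let ⟨_, st₁, hexec₁, ht₁, hR⟩ := h
  let ⟨_, _, hexec₂, ht₂, hQ⟩ := h' st₁ hexec₁.frame hR
  ⟨_, _, hexec₁.seq hexec₂, add_le_add ht₁ ht₂, hQ⟩

theorem seq_setNat {i : ℕ} {e : NExp} (h : Runs O d (st.setNat i (e.val st)) T Q) :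
    Runs O (.seq (.setNat i e) d) st (e.cost + 1 + T) Q :=
  seq (R := (· = st.setNat i (e.val st))) (setNat rfl) fun _ _ hst => hst ▸ h

theorem seq_setReal {i : ℕ} {e : RExp} (h : Runs O d (st.setReal i (e.val st)) T Q) :
    Runs O (.seq (.setReal i e) d) st (e.cost + 1 + T) Q :=
  seq (R := (· = st.setReal i (e.val st))) (setReal rfl) fun _ _ hst => hst ▸ h

theorem seq_put {a : ℕ} {i : NExp} {e : RExp}
    (h : Runs O d (st.setArr a (Function.update (st.arr a) (i.val st) (e.val st))) T Q) :
    Runs O (.seq (.put a i e) d) st (i.cost + e.cost + 1 + T) Q :=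
  seq (R := (· = st.setArr a (Function.update (st.arr a) (i.val st) (e.val st)))) (put rfl)
    fun _ _ hst => hst ▸ h

theorem branch (h₁ : b.holds st → Runs O c st T₁ Q) (h₂ : ¬ b.holds st → Runs O d st T₂ Q) :
    Runs O (.branch b c d) st (b.cost + max T₁ T₂) Q := by
  by_cases h : b.holds st
  · obtain ⟨t, st', hexec, ht, hQ⟩ := h₁ h
    exact ⟨_, _, .branchTrue h hexec, add_le_add_right (ht.trans (le_max_left _ _)) _, hQ⟩
  · obtain ⟨t, st', hexec, ht, hQ⟩ := h₂ h
    exact ⟨_, _, .branchFalse h hexec, add_le_add_right (ht.trans (le_max_right _ _)) _, hQ⟩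

/-- The index of the invariant `I` bounds the number of iterations that are left. -/
theorem loop (I : ℕ → State → Prop) {B : ℕ} (k : ℕ) (hI : I k st)
    (hstep : ∀ k st₁, Frame c st st₁ → I k st₁ → b.holds st₁ → ∃ l < k, Runs O c st₁ B (I l)) :
    Runs O (.loop b c) st (k * (b.cost + B) + b.cost)
      (fun st' => (∃ k, I k st') ∧ ¬ b.holds st') := by
  suffices ∀ k st₁, Frame c st st₁ → I k st₁ → Runs O (.loop b c) st₁ (k * (b.cost + B) + b.cost)
      (fun st' => (∃ k, I k st') ∧ ¬ b.holds st') from this k st (Frame.refl _ _) hI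
  intro k
  induction k using Nat.strong_induction_on with
  | _ k ih =>
    intro st₁ hframe hI
    by_cases hb : b.holds st₁
    · obtain ⟨l, hlk, t, st₂, hexec₁, ht, hIl⟩ := hstep k st₁ hframe hI hb
      obtain ⟨t', st₃, hexec₂, ht', hQ⟩ := ih l hlk st₂ (hframe.trans hexec₁.frame) hIl
      refine ⟨_, _, .loopTrue hb hexec₁ hexec₂, ?_, hQ⟩
      calc b.cost + t + t' ≤ b.cost + B + (l * (b.cost + B) + b.cost) :=
            add_le_add (add_le_add_right ht _) ht'
        _ = (l + 1) * (b.cost + B) + b.cost := by ring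
        _ ≤ k * (b.cost + B) + b.cost := by gcongr; exact hlk
    · exact ⟨_, _, .loopFalse hb, Nat.le_add_left _ _, ⟨k, hI⟩, hb⟩

end Runs

/-- `for i = 0, …, n - 1 do c`, with `n` held by a register. -/
def forLoop (i n : ℕ) (c : Cmd) : Cmd :=
  .seq (.setNat i (.const 0))
    (.loop (.natLT (.reg i) (.reg n)) (.seq c (.setNat i (.add (.reg i) (.const 1)))))

theorem Runs.forLoop (I : ℕ → State → Prop) {i n N B : ℕ} (hN : st.nat n = N) (hin : n ≠ i)
    (hi : i ∉ c.natWrites) (hn : n ∉ c.natWrites) (h0 : I 0 (st.setNat i 0))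
    (hstep : ∀ k st₁, Frame (forLoop i n c) st st₁ → k < N → st₁.nat i = k → I k st₁ →
      Runs O c st₁ B fun st₂ => I (k + 1) (st₂.setNat i (k + 1))) :
    Runs O (forLoop i n c) st (N * (B + 7) + 5) (I N) := by
  have hframe {st₁}
      (h : Frame (.seq c (.setNat i (.add (.reg i) (.const 1)))) (st.setNat i 0) st₁) :
      Frame (RealRAM.forLoop i n c) st st₁ :=
    (Exec.setNat (O := O) st i (.const 0)).frame.seq h.loop
  have hbound {st₁} (h : Frame (RealRAM.forLoop i n c) st st₁) : st₁.nat n = N := by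
    rw [h.nat n, hN]
    simp [RealRAM.forLoop, Cmd.natWrites, hn, hin]
  have hloop := Runs.loop (O := O) (b := .natLT (.reg i) (.reg n)) (B := B + 4)
    (c := .seq c (.setNat i (.add (.reg i) (.const 1)))) (st := st.setNat i 0)
    (fun k st₁ => k ≤ N ∧ st₁.nat i = N - k ∧ I (N - k) st₁) N
    ⟨le_rfl, by simp, by simpa using h0⟩ fun k st₁ hf ⟨_, hk, hI⟩ hb => by
      simp only [Cmp.holds, NExp.val, hbound (hframe hf), hk] at hb
      refine ⟨k - 1, by lia, (hstep _ st₁ (hframe hf) hb hk hI).seq fun st₂ hf₂ hI₂ => setNat ?_⟩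
      have hsucc : N - (k - 1) = N - k + 1 := by lia
      simp only [NExp.val, hf₂.nat i hi, hk, hsucc]
      exact ⟨by lia, by simp, hI₂⟩
  refine of_le (seq_setNat (hloop.imp ?_)) ?_
  · rintro st' hf ⟨⟨k, _, hk, hI⟩, hb⟩
    simp only [Cmp.holds, NExp.val, hbound (hframe ⟨hf.nat, hf.real, hf.arr⟩), hk] at hb
    rwa [show N - k = N by lia] at hI
  · simp only [NExp.cost, Cmp.cost]
    ring_nf
    rfl

theorem Runs.forLoop_put {i n a N : ℕ} {ix : NExp} {e : RExp} (g : ℕ → ℕ) (v : ℕ → ℝ)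
    (hg : g.Injective) (hN : st.nat n = N) (hin : n ≠ i)
    (hval : ∀ k st₁, Frame (RealRAM.forLoop i n (.put a ix e)) st st₁ → k < N → st₁.nat i = k →
      ix.val st₁ = g k ∧ e.val st₁ = v k) :
    Runs O (RealRAM.forLoop i n (.put a ix e)) st (N * (ix.cost + e.cost + 8) + 5)
      fun st' => ∀ k < N, st'.arr a (g k) = v k := by
  refine Runs.forLoop (fun k st₁ => ∀ j < k, st₁.arr a (g j) = v j) hN hin List.not_mem_nil
    List.not_mem_nil (fun j hj => (Nat.not_lt_zero j hj).elim)
    fun k st₁ hf hk hi hI => Runs.put fun j hj => ?_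
  obtain ⟨hix, he⟩ := hval k st₁ hf hk hi
  rcases Nat.lt_succ_iff_lt_or_eq.1 hj with hjk | rfl
  · simp [hix, hg.ne hjk.ne, hI j hjk]
  · simp [hix, he]

theorem Runs.forLoop_setReal_add {i n x N : ℕ} {e : RExp} (v : ℕ → ℝ) (hN : st.nat n = N)
    (hin : n ≠ i)
    (hval : ∀ k st₁, Frame (RealRAM.forLoop i n (.setReal x (.add (.reg x) e))) st st₁ → k < N →
      st₁.nat i = k → e.val st₁ = v k) :
    Runs O (RealRAM.forLoop i n (.setReal x (.add (.reg x) e))) st (N * (e.cost + 10) + 5)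
      fun st' => st'.real x = st.real x + ∑ k ∈ Finset.range N, v k := by
  refine of_le (Runs.forLoop (fun k st₁ => st₁.real x = st.real x + ∑ k ∈ Finset.range k, v k)
    hN hin List.not_mem_nil List.not_mem_nil (by simp) fun k st₁ hf hk hi hI => setReal ?_) ?_
  · simp [RExp.val, hI, hval k st₁ hf hk hi, Finset.sum_range_succ, add_assoc]
  · simp only [RExp.cost]
    ring_nf
    rfl

section Expressions

variable (st : State) (e f : RExp)

/-- The expression for the absolute value. -/
def RExp.abs : RExp := .sqrt (.mul e e)

/-- The expression for the maximum. -/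
def RExp.max : RExp := .div (.add (.add e f) (.abs (.sub e f))) (.const 2)

/-- The expression for the minimum. -/
def RExp.min : RExp := .div (.sub (.add e f) (.abs (.sub e f))) (.const 2)

@[simp] theorem RExp.val_abs : e.abs.val st = |e.val st| :=
  Real.sqrt_mul_self_eq_abs _

@[simp] theorem RExp.val_max : (e.max f).val st = Max.max (e.val st) (f.val st) := by
  simp only [RExp.max, RExp.val, RExp.val_abs, ← max_sub_min_eq_abs', Int.cast_ofNat]
  linarith [min_add_max (e.val st) (f.val st)]

@[simp] theorem RExp.val_min : (e.min f).val st = Min.min (e.val st) (f.val st) := by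
  simp only [RExp.min, RExp.val, RExp.val_abs, ← max_sub_min_eq_abs', Int.cast_ofNat]
  linarith [min_add_max (e.val st) (f.val st)]

end Expressions

/-- The memory contains an instance of the vector problem, in the format of `SolvesVec`. -/
structure HoldsInstance (st : State) {p : ℕ} (δ η : ℝ) (q : Fin p → ℝ) : Prop where
  dim : st.nat 0 = p
  weight : st.real 0 = δ
  bound : st.real 1 = η
  vec : HoldsVec (st.arr 0) q

theorem SolvesVec.of_runs {α : ENNReal} {P : Cmd} {T : ℕ → ℕ} (hP : P.Elementary)
    (hrun : ∀ (O : Routine) (st : State) {p : ℕ} (δ η : ℝ) (q : Fin p → ℝ), 0 ≤ δ → 0 ≤ η →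
      HoldsInstance st δ η q →
        Runs O P st (T p) fun st' => ∃ s, HoldsVec (st'.arr 1) s ∧ IsVecSol α δ η q s) :
    SolvesVec α P T := by
  refine ⟨hP, fun O p q δ η hδ hη st hdim hweight hbound hvec => ?_⟩
  obtain ⟨t, st', hexec, ht, s, hs, hsol⟩ :=
    hrun O st δ η q hδ hη ⟨hdim, hweight, hbound, hvec⟩
  exact ⟨t, st', s, hexec, ht, hs, hsol⟩

/-- Write the values of the expression `e` to the array `1`, one for each value of register `1`
below the dimension. -/
def mapProg (e : RExp) : Cmd := forLoop 1 0 (.put 1 (.reg 1) e)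

theorem runs_mapProg (O : Routine) {st : State} {p : ℕ} {q : Fin p → ℝ} {e : RExp} (f : ℝ → ℝ)
    (hdim : st.nat 0 = p) (hvec : HoldsVec (st.arr 0) q)
    (he : ∀ st₁ : State, st₁.real = st.real → e.val st₁ = f (st₁.arr 0 (st₁.nat 1))) :
    Runs O (mapProg e) st (p * (e.cost + 9) + 5) fun st' =>
      HoldsVec (st'.arr 1) fun i => f (q i) := by
  have hfill := Runs.forLoop_put (O := O) (st := st) (i := 1) (n := 0) (a := 1) (ix := .reg 1)
    (e := e) id (fun k => f (st.arr 0 k)) Function.injective_id hdim (by decide)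
    fun k st₁ hf _ hk => ⟨hk, by
      rw [he st₁ (funext fun i => hf.real i List.not_mem_nil), hk,
        hf.arr 0 (by simp [forLoop, Cmd.arrWrites])]⟩
  refine (hfill.imp fun st' _ hst' i => ?_).of_le ?_
  · exact (hst' i i.2).trans (congrArg f (hvec i))
  · simp only [NExp.cost]
    ring_nf
    rfl

/-- Write the Euclidean norm of the array `0` to the real register `2`. -/
def normProg : Cmd :=
  .seq (.setReal 2 (.const 0)) <|
  .seq (forLoop 1 0 (.setReal 2 (.add (.reg 2) (.mul (.get 0 (.reg 1)) (.get 0 (.reg 1)))))) <|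
  .setReal 2 (.sqrt (.reg 2))

/-- Scaling by the shrunk norm, which solves the vector problem for the Euclidean norm. -/
def scaleProg : Cmd :=
  .seq normProg <|
  .seq (.setReal 2 (.div (.min (.max (.const 0) (.sub (.reg 2) (.reg 0))) (.reg 1)) (.reg 2))) <|
  mapProg (.mul (.reg 2) (.get 0 (.reg 1)))

theorem runs_normProg (O : Routine) {st : State} {p : ℕ} {q : Fin p → ℝ} (hdim : st.nat 0 = p)
    (hvec : HoldsVec (st.arr 0) q) :
    Runs O normProg st (15 * p + 10) fun st' => st'.real 2 = ellNorm 2 q := by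
  have hsum := Runs.forLoop_setReal_add (O := O) (st := st.setReal 2 0) (i := 1) (n := 0) (x := 2)
    (e := .mul (.get 0 (.reg 1)) (.get 0 (.reg 1))) (fun k => st.arr 0 k ^ 2) hdim (by decide)
    fun k st₁ hf _ hk => by
      have harr : st₁.arr 0 = st.arr 0 := hf.arr 0 (by decide)
      simp only [RExp.val, NExp.val, hk, harr, sq]
  refine Runs.of_le (Runs.seq_setReal <| Runs.seq (by simpa [RExp.val] using hsum)
    fun st₁ _ hst₁ => Runs.setReal ?_) ?_
  · have hrange : ∑ k ∈ Finset.range p, st.arr 0 k ^ 2 = ∑ i, q i ^ 2 := by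
      simp only [Finset.sum_range, hvec _]
    simp [RExp.val, hst₁, hrange, ellNorm_two]
  · simp only [RExp.cost, NExp.cost]
    lia

theorem runs_scaleProg (O : Routine) {st : State} {p : ℕ} {δ η : ℝ} {q : Fin p → ℝ}
    (h : HoldsInstance st δ η q) :
    Runs O scaleProg st (30 * p + 100) fun st' => HoldsVec (st'.arr 1) fun i =>
      min (max 0 (ellNorm 2 q - δ)) η / ellNorm 2 q * q i := by
  refine Runs.of_le ((runs_normProg O h.dim h.vec).seq fun st₁ hf hnorm => Runs.seq_setReal <|
    runs_mapProg O (fun x => min (max 0 (ellNorm 2 q - δ)) η / ellNorm 2 q * x)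
      ((hf.nat 0 (by decide)).trans h.dim) ?_ fun st₂ hst₂ => ?_) ?_
  · rw [State.setReal_arr, hf.arr 0 (by decide)]
    exact h.vec
  · have hδ : st₁.real 0 = δ := (hf.real 0 (by decide)).trans h.weight
    have hη : st₁.real 1 = η := (hf.real 1 (by decide)).trans h.bound
    simp [RExp.val, NExp.val, hst₂, hnorm, hδ, hη]
  · simp only [RExp.cost, RExp.max, RExp.min, RExp.abs, NExp.cost]
    lia

theorem solvesVec_two : SolvesVec 2 scaleProg fun p => 30 * p + 100 :=
  .of_runs (by simp [scaleProg, normProg, mapProg, forLoop, Cmd.Elementary])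
    fun O _ _ _ _ q hδ hη h =>
      (runs_scaleProg O h).imp fun _ _ hvec => ⟨_, hvec, isVecSol_two hδ hη q⟩

theorem isBigO_linear (a b : ℕ) :
    (fun p => ((a * p + b : ℕ) : ℝ)) =O[Filter.atTop] fun p : ℕ => (p : ℝ) := by
  refine .of_bound (a + b) (Filter.eventually_atTop.2 ⟨1, fun p hp => ?_⟩)
  simp only [Real.norm_natCast]
  exact_mod_cast (by nlinarith : a * p + b ≤ (a + b) * p)

/-! ### A tournament tree -/

/-- The array `f` holds a tournament on `p` leaves, except possibly at the nodes in `D`.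
Node `k` has the children `2k` and `2k + 1`, the root is node `1`, and the leaves are the nodes from
`p` to `2p - 1`. -/
def IsTournament {R : Type*} [LinearOrder R] (p : ℕ) (D : Set ℕ) (f : ℕ → R) : Prop :=
  ∀ k ∉ D, 0 < k → k < p → f k = max (f (k + k)) (f (k + k + 1))

namespace IsTournament

variable {R : Type*} [LinearOrder R] {p k : ℕ} {D E : Set ℕ} {f : ℕ → R}

theorem mono (h : IsTournament p D f) (hDE : ∀ k ∈ D, 0 < k → k < p → k ∈ E) :
    IsTournament p E f :=
  fun k hk h0 hp => h k (fun hD => hk (hDE k hD h0 hp)) h0 hp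

theorem le_root (h : IsTournament p ∅ f) (hk : 0 < k) (hkp : k < 2 * p) : f k ≤ f 1 := by
  induction k using Nat.strong_induction_on with
  | _ k ih =>
    obtain rfl | hk1 : k = 1 ∨ 1 < k := by lia
    · rfl
    · have hparent := h (k / 2) (Set.notMem_empty _) (Nat.div_pos hk1 two_pos) (by lia)
      refine le_trans ?_ (ih (k / 2) (Nat.div_lt_self hk one_lt_two) (Nat.div_pos hk1 two_pos)
        ((Nat.div_le_self k 2).trans_lt hkp))
      rw [hparent]
      obtain hk2 | hk2 : k = k / 2 + k / 2 ∨ k = k / 2 + k / 2 + 1 := by lia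
      · exact le_max_of_le_left (congrArg f hk2).le
      · exact le_max_of_le_right (congrArg f hk2).le

theorem update_max (h : IsTournament p D f) (_ : 0 < k) :
    IsTournament p (insert (k / 2) (D \ {k}))
      (Function.update f k (max (f (k + k)) (f (k + k + 1)))) := by
  intro j hj h0 hp
  have hjk : j ≠ k / 2 := fun h => hj (h ▸ Set.mem_insert _ _)
  rw [Function.update_of_ne (a := j + j) (by lia), Function.update_of_ne (a := j + j + 1) (by lia)]
  by_cases hne : j = k
  · rw [hne, Function.update_self]
  · rw [Function.update_of_ne hne]
    exact h j (fun hD => hj (Set.mem_insert_of_mem _ ⟨hD, hne⟩)) h0 hp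

theorem update_leaf (h : IsTournament p ∅ f) (hk : p ≤ k) (x : R) :
    IsTournament p {k / 2} (Function.update f k x) := by
  intro j hj h0 hp
  have hjk : j ≠ k / 2 := hj
  rw [Function.update_of_ne (by lia), Function.update_of_ne (by lia),
    Function.update_of_ne (by lia)]
  exact h j (Set.notMem_empty j) h0 hp

end IsTournament

/-- Recompute the node in register `2` of the tree in array `2` from its children. -/
def pullProg : Cmd :=
  .put 2 (.reg 2) (.max (.get 2 (.add (.reg 2) (.reg 2)))
    (.get 2 (.add (.add (.reg 2) (.reg 2)) (.const 1))))

/-- Compute the internal nodes of the tree in array `2`, with `p` in register `0`. -/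
def buildProg : Cmd :=
  .seq (.setNat 2 (.reg 0)) (.loop (.natLT (.const 1) (.reg 2))
    (.seq (.setNat 2 (.sub (.reg 2) (.const 1))) pullProg))

/-- Move from the node in register `2` to a child with the same value. -/
def childProg : Cmd :=
  .branch (.realLT (.get 2 (.add (.reg 2) (.reg 2))) (.get 2 (.reg 2)))
    (.setNat 2 (.add (.add (.reg 2) (.reg 2)) (.const 1)))
    (.setNat 2 (.add (.reg 2) (.reg 2)))

/-- Descend from the root to a leaf that holds the maximum, whose number is left in register `2`. -/
def descendProg : Cmd :=
  .seq (.setNat 2 (.const 1)) (.loop (.natLT (.reg 2) (.reg 0)) childProg)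

/-- Recompute the ancestors of the node in register `2`. -/
def ascendProg : Cmd :=
  .loop (.natLT (.const 1) (.reg 2)) (.seq (.setNat 2 (.half (.reg 2))) pullProg)

/-- Overwrite a maximal leaf with `-1`, which removes it as long as the entries that remain are
nonnegative. -/
def extractProg : Cmd :=
  .seq descendProg (.seq (.put 2 (.reg 2) (.const (-1))) ascendProg)

variable {O : Routine} {st : State} {p k L : ℕ} {D : Set ℕ}

theorem runs_pullProg (hk : st.nat 2 = k) (hk0 : 0 < k) (hkp : k < p)
    (ht : IsTournament p D (st.arr 2)) :
    Runs O pullProg st 40 fun st' =>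
      IsTournament p (insert (k / 2) (D \ {k})) (st'.arr 2) ∧
        ∀ j, p ≤ j → st'.arr 2 j = st.arr 2 j := by
  refine Runs.of_le (Runs.put ?_) ?_
  · simp only [RExp.val_max, RExp.val, NExp.val, State.setArr_arr, if_true, hk]
    exact ⟨ht.update_max hk0, fun j hj => Function.update_of_ne (by lia) _ _⟩
  · simp [RExp.cost, RExp.max, RExp.abs, NExp.cost]

theorem runs_buildProg (hp : st.nat 0 = p) :
    Runs O buildProg st (60 * p + 10) fun st' =>
      IsTournament p ∅ (st'.arr 2) ∧ ∀ j, p ≤ j → st'.arr 2 j = st.arr 2 j := by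
  refine Runs.of_le (Runs.seq_setNat <| (Runs.loop (B := 44) (fun k st₁ => st₁.nat 2 = k ∧ k ≤ p ∧
    IsTournament p {j | j < k} (st₁.arr 2) ∧ ∀ j, p ≤ j → st₁.arr 2 j = st.arr 2 j) p ?_ ?_).imp
      ?_) ?_
  · exact ⟨hp, le_rfl, fun j hj _ hjp => (hj hjp).elim, fun _ _ => rfl⟩
  · rintro k st₁ - ⟨hk, hkp, htree, hleaf⟩ hb
    simp only [Cmp.holds, NExp.val, hk] at hb
    have hpull := runs_pullProg (O := O) (st := st₁.setNat 2 (k - 1)) (k := k - 1) rfl (by lia)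
      (by lia) htree
    refine ⟨k - 1, by lia, Runs.seq_setNat (e := .sub (.reg 2) (.const 1)) (T := 40) ?_⟩
    simp only [NExp.val, hk]
    refine hpull.imp fun st₂ hf ⟨htree', hleaf'⟩ => ⟨hf.nat 2 (by decide), by lia,
      htree'.mono fun j hj _ _ => ?_, fun j hj => (hleaf' j hj).trans (hleaf j hj)⟩
    obtain rfl | ⟨hjk, hne⟩ := hj
    · exact Nat.div_lt_self (by lia) one_lt_two
    · exact lt_of_le_of_ne (Nat.le_sub_one_of_lt hjk) hne
  · rintro st' - ⟨⟨k, hk, -, htree, hleaf⟩, hb⟩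
    simp only [Cmp.holds, NExp.val, hk] at hb
    exact ⟨htree.mono fun j hj _ _ => absurd (lt_of_lt_of_le hj (not_lt.1 hb)) (by lia), hleaf⟩
  · simp only [NExp.cost, Cmp.cost]
    lia

theorem runs_childProg (hpos : 0 < st.nat 2) (hlt : st.nat 2 < p)
    (ht : IsTournament p ∅ (st.arr 2)) :
    Runs O childProg st 14 fun st' =>
      (st'.nat 2 = st.nat 2 + st.nat 2 ∨ st'.nat 2 = st.nat 2 + st.nat 2 + 1) ∧
        st.arr 2 (st'.nat 2) = st.arr 2 (st.nat 2) := by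
  have hmax := ht (st.nat 2) (Set.notMem_empty _) hpos hlt
  refine Runs.of_le (Runs.branch (fun hright => Runs.setNat ⟨.inr rfl, ?_⟩)
    fun hleft => Runs.setNat ⟨.inl rfl, ?_⟩) ?_
  · simp only [Cmp.holds, RExp.val, NExp.val, hmax, lt_max_iff, lt_irrefl, false_or] at hright
    exact ((hmax.trans (max_eq_right hright.le)).symm :)
  · simp only [Cmp.holds, RExp.val, NExp.val, not_lt] at hleft
    exact le_antisymm ((le_max_left _ _).trans hmax.ge) hleft
  · decide

theorem runs_descendProg (hp : st.nat 0 = p) (hp0 : 0 < p) (hL : p ≤ 2 ^ L)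
    (ht : IsTournament p ∅ (st.arr 2)) :
    Runs O descendProg st (20 * L + 10) fun st' =>
      p ≤ st'.nat 2 ∧ st'.nat 2 < 2 * p ∧ st.arr 2 (st'.nat 2) = st.arr 2 1 := by
  refine Runs.of_le (Runs.seq_setNat <| (Runs.loop (B := 14) (fun l st₁ =>
    p ≤ st₁.nat 2 * 2 ^ l ∧ 0 < st₁.nat 2 ∧ st₁.nat 2 < 2 * p ∧
      st.arr 2 (st₁.nat 2) = st.arr 2 1) L ?_ ?_).imp ?_) ?_
  · simpa [NExp.val] using ⟨hL, by lia⟩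
  · rintro l st₁ hf ⟨hheight, hpos, _, hval⟩ hb
    simp only [Cmp.holds, NExp.val, (hf.nat 0 (by decide)).trans hp] at hb
    have harr : st₁.arr 2 = st.arr 2 := hf.arr 2 (by decide)
    obtain _ | l := l
    · lia
    refine ⟨l, by lia, (runs_childProg hpos hb (harr ▸ ht)).imp fun st₂ _ ⟨_, hval'⟩ =>
      ⟨hheight.trans ?_, by lia, by lia, ?_⟩⟩
    · rw [pow_succ', ← mul_assoc]
      gcongr
      lia
    · rwa [harr, hval] at hval'
  · rintro st' hf ⟨⟨l, -, -, hlt, hval⟩, hb⟩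
    simp only [Cmp.holds, NExp.val, (hf.nat 0 (by decide)).trans hp] at hb
    exact ⟨not_lt.1 hb, hlt, hval⟩
  · simp only [NExp.cost, Cmp.cost]
    lia

theorem runs_ascendProg (hpos : 0 < st.nat 2) (hlt : st.nat 2 < 2 * p) (hL : p ≤ 2 ^ L)
    (ht : IsTournament p {st.nat 2 / 2} (st.arr 2)) :
    Runs O ascendProg st (60 * L + 10) fun st' =>
      IsTournament p ∅ (st'.arr 2) ∧ ∀ j, p ≤ j → st'.arr 2 j = st.arr 2 j := by
  refine Runs.of_le ((Runs.loop (B := 44) (fun l st₁ => 0 < st₁.nat 2 ∧ st₁.nat 2 < 2 * p ∧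
    st₁.nat 2 < 2 ^ (l + 1) ∧ IsTournament p {st₁.nat 2 / 2} (st₁.arr 2) ∧
      ∀ j, p ≤ j → st₁.arr 2 j = st.arr 2 j) L ?_ ?_).imp ?_) ?_
  · exact ⟨hpos, hlt, by lia, ht, fun _ _ => rfl⟩
  · rintro l st₁ - ⟨hpos, hlt, hheight, htree, hleaf⟩ hb
    simp only [Cmp.holds, NExp.val] at hb
    obtain _ | l := l
    · lia
    have hpull := runs_pullProg (O := O) (st := st₁.setNat 2 (st₁.nat 2 / 2)) rfl
      (Nat.div_pos hb two_pos) (Nat.div_lt_of_lt_mul hlt) htree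
    refine ⟨l, by lia, Runs.of_le (Runs.seq_setNat (e := .half (.reg 2)) <|
      hpull.imp fun st₂ hf ⟨htree', hleaf'⟩ => ?_) (by decide)⟩
    have hnode : st₂.nat 2 = st₁.nat 2 / 2 := hf.nat 2 (by decide)
    refine ⟨by lia, by lia, by lia, htree'.mono fun j hj _ _ => ?_,
      fun j hj => (hleaf' j hj).trans (hleaf j hj)⟩
    simpa [hnode] using hj
  · rintro st' - ⟨⟨l, hpos, -, -, htree, hleaf⟩, hb⟩
    simp only [Cmp.holds, NExp.val] at hb
    refine ⟨htree.mono fun j hj hj0 _ => ?_, hleaf⟩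
    rw [Set.mem_singleton_iff.1 hj] at hj0
    lia
  · simp only [NExp.cost, Cmp.cost]
    lia

theorem runs_extractProg (hp : st.nat 0 = p) (hp0 : 0 < p) (hL : p ≤ 2 ^ L)
    (ht : IsTournament p ∅ (st.arr 2)) :
    Runs O extractProg st (80 * L + 30) fun st' => ∃ i : Fin p, st.arr 2 (p + i) = st.arr 2 1 ∧
      IsTournament p ∅ (st'.arr 2) ∧
      ∀ j : Fin p, st'.arr 2 (p + j) = if j = i then -1 else st.arr 2 (p + j) := by
  refine Runs.of_le ((runs_descendProg hp hp0 hL ht).seq fun st₁ hf ⟨hleaf, hlt, hroot⟩ =>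
    Runs.seq_put <| (runs_ascendProg (p := p) (L := L) ?_ ?_ hL ?_).imp
      fun st' _ ⟨htree, hrest⟩ => ?_) ?_
  · exact hp0.trans_le hleaf
  · exact hlt
  · rw [← hf.arr 2 (by decide)] at ht
    simpa [NExp.val] using ht.update_leaf hleaf _
  · obtain ⟨i, hi⟩ := Nat.exists_eq_add_of_le hleaf
    refine ⟨⟨i, by lia⟩, by rw [← hroot, hi], htree, fun j => ?_⟩
    rw [hrest _ (Nat.le_add_right _ _)]
    simp [NExp.val, RExp.val, hi, hf.arr 2 (by decide), Function.update_apply, Fin.ext_iff]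
  · simp only [NExp.cost, RExp.cost]
    lia

/-! ### Levels by repeated extraction of the maximum -/

/-- Load the absolute values of the array `0` into the leaves of the tree in array `2`. -/
def loadProg : Cmd := forLoop 1 0 (.put 2 (.add (.reg 0) (.reg 1)) (.abs (.get 0 (.reg 1))))

/-- Extract a maximal leaf, and update the sum and the number of the extracted entries in the real
registers `4` and `5` and their level for the excess in register `2` in register `3`. -/
def raiseProg : Cmd :=
  .seq (.setReal 4 (.add (.reg 4) (.get 2 (.const 1)))) <|
  .seq (.setReal 5 (.add (.reg 5) (.const 1))) <|
  .seq (.setReal 3 (.max (.reg 3) (.div (.sub (.reg 4) (.reg 2)) (.reg 5)))) extractProg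

/-- Extract all leaves. -/
def sweepProg : Cmd :=
  .seq (.setReal 3 (.const 0)) <| .seq (.setReal 4 (.const 0)) <| .seq (.setReal 5 (.const 0)) <|
  forLoop 1 0 raiseProg

/-- Compute the level of the absolute values of the array `0` for the excess in the real
register `2`, and write it to the real register `3`. -/
def levelProg : Cmd := .seq loadProg (.seq buildProg sweepProg)

/-- The state of `raiseProg` once the entries of `a` at the indices in `E`, which are the largest
ones, have been extracted. -/
structure Extracted {p : ℕ} (a : Fin p → ℝ) (c : ℝ) (E : Finset (Fin p)) (st : State) : Prop where
  tree : IsTournament p ∅ (st.arr 2)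
  leaf : ∀ i : Fin p, st.arr 2 (p + i) = if i ∈ E then -1 else a i
  sum : st.real 4 = ∑ i ∈ E, a i
  card : st.real 5 = E.card
  level : IsLevel E a c (st.real 3)
  le : ∀ i ∈ E, ∀ j ∉ E, a j ≤ a i

variable {O : Routine} {st : State} {p L : ℕ} {c : ℝ} {a : Fin p → ℝ} {E : Finset (Fin p)}

theorem Extracted.le_root (h : Extracted a c E st) {j : Fin p} (hj : j ∉ E) :
    a j ≤ st.arr 2 1 := by
  have hleaf := h.leaf j
  rw [if_neg hj] at hleaf
  exact hleaf ▸ h.tree.le_root (by lia) (by lia)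

theorem Extracted.notMem_of_leaf_eq_root (ha : ∀ i, 0 ≤ a i) (h : Extracted a c E st)
    (hE : E.card < p) {i : Fin p} (hi : st.arr 2 (p + i) = st.arr 2 1) : i ∉ E := fun hiE => by
  obtain ⟨j, -, hj⟩ := Finset.exists_mem_notMem_of_card_lt_card (s := E) (t := Finset.univ)
    (by rwa [Finset.card_univ, Fintype.card_fin])
  have hroot := (ha j).trans (h.le_root hj)
  rw [← hi, h.leaf, if_pos hiE] at hroot
  linarith

theorem runs_raiseProg (hp : st.nat 0 = p) (hL : p ≤ 2 ^ L) (hc : st.real 2 = c)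
    (ha : ∀ i, 0 ≤ a i) (h : Extracted a c E st) (hE : E.card < p) :
    Runs O raiseProg st (80 * L + 70) fun st' => ∃ i ∉ E, Extracted a c (insert i E) st' := by
  refine Runs.of_le (Runs.seq_setReal <| Runs.seq_setReal <| Runs.seq_setReal <|
    (runs_extractProg (by exact hp) (Nat.zero_lt_of_lt hE) hL (by exact h.tree)).imp
      fun st' hf ⟨i, hi, htree, hleaf⟩ => ?_) ?_
  · have hiE : i ∉ E := h.notMem_of_leaf_eq_root ha hE hi
    have hroot : st.arr 2 1 = a i := hi.symm.trans ((h.leaf i).trans (if_neg hiE))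
    have hsum : st'.real 4 = ∑ j ∈ insert i E, a j := by
      rw [hf.real 4 (by decide), Finset.sum_insert hiE, add_comm, ← h.sum, ← hroot]
      rfl
    have hcard : st'.real 5 = (insert i E).card := by
      rw [hf.real 5 (by decide), Finset.card_insert_of_notMem hiE, Nat.cast_succ, ← h.card]
      simp [RExp.val]
    have hlevel : st'.real 3 =
        max (st.real 3) ((∑ j ∈ insert i E, a j - c) / (insert i E).card) := by
      rw [← hsum, ← hcard, hf.real 3 (by decide), hf.real 4 (by decide), hf.real 5 (by decide)]
      simp [RExp.val, hc]
    refine ⟨i, hiE, htree, fun j => ?_, hsum, hcard, ?_, fun j hj k hk => ?_⟩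
    · simp only [hleaf, State.setReal_arr, h.leaf, Finset.mem_insert, ite_or]
    · rw [hlevel]
      exact h.level.insert hiE fun j hj => h.le j hj i hiE
    · rw [Finset.mem_insert, not_or] at hk
      obtain rfl | hj := Finset.mem_insert.1 hj
      · exact (h.le_root hk.2).trans_eq hroot
      · exact h.le j hj k hk.2
  · simp only [RExp.cost, NExp.cost, RExp.max, RExp.abs]
    lia

theorem runs_loadProg {q : Fin p → ℝ} (hp : st.nat 0 = p) (hq : HoldsVec (st.arr 0) q) :
    Runs O loadProg st (20 * p + 5) fun st' => ∀ i : Fin p, st'.arr 2 (p + i) = |q i| := by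
  have hfill := Runs.forLoop_put (O := O) (st := st) (i := 1) (n := 0) (a := 2)
    (ix := .add (.reg 0) (.reg 1)) (e := .abs (.get 0 (.reg 1))) (p + ·) (fun k => |st.arr 0 k|)
    (add_right_injective p) hp (by decide) fun k st₁ hf _ hk => ⟨?_, ?_⟩
  · refine (hfill.imp fun st' _ hst' i => ?_).of_le ?_
    · rw [hst' i i.2, hq i]
    · simp only [NExp.cost, RExp.cost, RExp.abs]
      lia
  · simp only [NExp.val, hk, (hf.nat 0 (by decide)).trans hp]
  · simp only [RExp.val_abs, RExp.val, NExp.val, hk, hf.arr 0 (by decide)]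

theorem runs_sweepProg (hp : st.nat 0 = p) (hL : p ≤ 2 ^ L) (hc : 0 ≤ st.real 2)
    (ha : ∀ i, 0 ≤ a i) (htree : IsTournament p ∅ (st.arr 2))
    (hleaf : ∀ i : Fin p, st.arr 2 (p + i) = a i) :
    Runs O sweepProg st (p * (80 * L + 80) + 20) fun st' =>
      IsLevel Finset.univ a (st.real 2) (st'.real 3) := by
  refine Runs.of_le (Runs.seq_setReal <| Runs.seq_setReal <| Runs.seq_setReal <|
    (Runs.forLoop (N := p) (B := 80 * L + 70)
      (fun k st' => ∃ E, E.card = k ∧ Extracted a (st.real 2) E st')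
      ?_ ?_ ?_ ?_ ?_ ?_).imp ?_) ?_
  · exact hp
  · decide
  · decide
  · decide
  · refine ⟨∅, rfl, htree, ?_, ?_, ?_, ?_, by simp⟩
    · simpa using hleaf
    · simp [RExp.val]
    · simp [RExp.val]
    · simpa [RExp.val] using isLevel_empty a hc
  · rintro k st₁ hf hk - ⟨E, rfl, hE⟩
    refine (runs_raiseProg ((hf.nat 0 (by decide)).trans hp) hL (hf.real 2 (by decide)) ha hE
      hk).imp fun st₂ _ ⟨i, hi, hins⟩ =>
        ⟨insert i E, Finset.card_insert_of_notMem hi, ?_⟩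
    exact { hins with }
  · rintro st' - ⟨E, hcard, hE⟩
    obtain rfl := Finset.eq_univ_of_card E (hcard.trans (Fintype.card_fin p).symm)
    exact hE.level
  · simp only [RExp.cost]
    lia

theorem runs_levelProg {q : Fin p → ℝ} (hp : st.nat 0 = p) (hL : p ≤ 2 ^ L)
    (hq : HoldsVec (st.arr 0) q) (hc : 0 ≤ st.real 2) :
    Runs O levelProg st (p * (80 * L + 200) + 100) fun st' =>
      IsLevel Finset.univ (fun i => |q i|) (st.real 2) (st'.real 3) := by
  refine Runs.of_le ((runs_loadProg hp hq).seq fun st₁ hf₁ hload =>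
    (runs_buildProg ((hf₁.nat 0 (by decide)).trans hp)).seq fun st₂ hf₂ ⟨htree, hleaf⟩ =>
      (?_ : Runs O sweepProg st₂ (p * (80 * L + 80) + 20) _)) ?_
  · have hreal : st₂.real 2 = st.real 2 :=
      (hf₂.real 2 (by decide)).trans (hf₁.real 2 (by decide))
    rw [← hreal] at hc ⊢
    exact runs_sweepProg ((hf₂.nat 0 (by decide)).trans ((hf₁.nat 0 (by decide)).trans hp)) hL hc
      (fun _ => abs_nonneg _) htree
      fun i => (hleaf _ (Nat.le_add_right _ _)).trans (hload i)
  · lia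

/-! ### Shrinkage for the sum norm and the maximum norm -/

/-- The entry of the array `0` in register `1`, clipped to the level in the real register `3`. -/
def clipExp : RExp := .max (.sub (.const 0) (.reg 3)) (.min (.get 0 (.reg 1)) (.reg 3))

/-- Map the array `0` by the expression `e`, after setting the real register `3` to the value of `t`
at the level for the excess in the real register `x`. -/
def levelMapProg (x : ℕ) (t e : RExp) : Cmd :=
  .seq (.setReal 2 (.reg x)) <| .seq levelProg <| .seq (.setReal 3 t) <| mapProg e

/-- Soft thresholding, which solves the vector problem for the sum norm. -/
def softProg : Cmd := levelMapProg 1 (.max (.reg 3) (.reg 0)) (.sub (.get 0 (.reg 1)) clipExp)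

/-- Clipping, which solves the vector problem for the maximum norm. -/
def clipProg : Cmd := levelMapProg 0 (.min (.reg 3) (.reg 1)) clipExp

/-- The running time of `softProg` and `clipProg`. -/
def logTime (p : ℕ) : ℕ := p * (80 * (Nat.log 2 p + 1) + 400) + 200

theorem le_two_pow_log (p : ℕ) : p ≤ 2 ^ (Nat.log 2 p + 1) :=
  (Nat.lt_pow_succ_log_self one_lt_two p).le

@[simp] theorem val_clipExp (st : State) :
    clipExp.val st = clip (st.real 3) (st.arr 0 (st.nat 1)) := by
  simp [clipExp, RExp.val, NExp.val, clip]

theorem runs_levelMapProg {δ η : ℝ} {q : Fin p → ℝ} (h : HoldsInstance st δ η q) {x : ℕ}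
    {t e : RExp} (g : ℝ → ℝ) (f : ℝ → ℝ → ℝ) (hc : 0 ≤ st.real x)
    (hcost : t.cost + e.cost ≤ 90)
    (ht : ∀ st₁ : State, st₁.real 0 = δ → st₁.real 1 = η → t.val st₁ = g (st₁.real 3))
    (he : ∀ st₁ : State, e.val st₁ = f (st₁.real 3) (st₁.arr 0 (st₁.nat 1))) :
    Runs O (levelMapProg x t e) st (logTime p) fun st' =>
      ∃ l, IsLevel Finset.univ (fun i => |q i|) (st.real x) l ∧
        HoldsVec (st'.arr 1) fun i => f (g l) (q i) := by
  refine Runs.of_le (Runs.seq_setReal <| (runs_levelProg (L := Nat.log 2 p + 1) (by exact h.dim)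
    (le_two_pow_log p) (by exact h.vec) (by exact hc)).seq fun st₁ hf hl => Runs.seq_setReal <|
    (runs_mapProg O (f (g (st₁.real 3))) (by exact (hf.nat 0 (by decide)).trans h.dim) ?_
      fun st₂ hst₂ => ?_).imp fun st' _ hst' => ⟨_, hl, hst'⟩) ?_
  · rw [State.setReal_arr, hf.arr 0 (by decide)]
    exact h.vec
  · have hreal : st₂.real 3 = g (st₁.real 3) := by
      rw [hst₂, State.setReal_real, if_pos rfl, ht st₁ ((hf.real 0 (by decide)).trans h.weight)
        ((hf.real 1 (by decide)).trans h.bound)]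
    rw [he, hreal]
  · simp only [RExp.cost, logTime]
    have hmap : p * e.cost ≤ p * 90 := Nat.mul_le_mul_left p (by lia)
    linarith

theorem solvesVec_one : SolvesVec 1 softProg logTime :=
  .of_runs (by simp [softProg, levelMapProg, mapProg, levelProg, loadProg, buildProg, sweepProg,
      raiseProg, extractProg, descendProg, childProg, ascendProg, pullProg, forLoop,
      Cmd.Elementary])
    fun _ _ _ δ _ _ hδ hη h =>
      (runs_levelMapProg h (max · δ) (fun l x => x - clip l x) (h.bound.symm ▸ hη) (by decide)
        (fun st₁ h₀ _ => by simp [RExp.val, h₀]) fun st₁ => by simp [RExp.val, NExp.val]).imp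
      fun _ _ ⟨_, hl, hvec⟩ => ⟨_, hvec, isVecSol_one hδ (h.bound ▸ hl)⟩

theorem solvesVec_top : SolvesVec ⊤ clipProg logTime :=
  .of_runs (by simp [clipProg, levelMapProg, mapProg, levelProg, loadProg, buildProg, sweepProg,
      raiseProg, extractProg, descendProg, childProg, ascendProg, pullProg, forLoop,
      Cmd.Elementary])
    fun _ _ _ _ η _ hδ hη h =>
      (runs_levelMapProg h (min · η) clip (h.weight.symm ▸ hδ) (by decide)
        (fun st₁ _ h₁ => by simp [RExp.val, h₁]) val_clipExp).imp
      fun _ _ ⟨_, hl, hvec⟩ => ⟨_, hvec, isVecSol_top hδ hη (h.weight ▸ hl)⟩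

theorem natLog_two_le (hp : p ≠ 0) : (Nat.log 2 p : ℝ) ≤ 2 * Real.log p := by
  have hpow : (Nat.log 2 p : ℝ) * Real.log 2 ≤ Real.log p := by
    rw [← Real.log_pow]
    exact Real.log_le_log (by positivity) (by exact_mod_cast Nat.pow_log_le_self 2 hp)
  nlinarith [Real.log_two_gt_d9, (Nat.log 2 p).cast_nonneg (α := ℝ)]

theorem isBigO_logTime : (fun p => (logTime p : ℝ)) =O[Filter.atTop]
    fun p : ℕ => (p : ℝ) * Real.log p := by
  refine .of_bound 1000 (Filter.eventually_atTop.2 ⟨3, fun p hp => ?_⟩)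
  have hp3 : (3 : ℝ) ≤ p := by exact_mod_cast hp
  have hlog : 1 ≤ Real.log p :=
    (Real.le_log_iff_exp_le (by linarith)).2 (Real.exp_one_lt_three.le.trans hp3)
  rw [Real.norm_natCast, Real.norm_of_nonneg (by positivity), logTime]
  push_cast
  nlinarith [natLog_two_le (p := p) (by lia)]

/-! ### The matrix program -/

variable {O : Routine} {st st' : State} {c P : Cmd} {K m n r : ℕ} {δ η : ℝ} {T : ℕ → ℕ}
  {α : ENNReal} {Y : Matrix (Fin m) (Fin n) ℝ} {U : Matrix (Fin m) (Fin r) ℝ} {s : Fin r → ℝ}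
  {V : Matrix (Fin n) (Fin r) ℝ}

theorem HoldsMat.readMat_eq {f : ℕ → ℝ} (h : HoldsMat f Y) : readMat f m n = Y :=
  Matrix.ext h

theorem holdsVec_writeVec (f : ℕ → ℝ) (s : Fin r → ℝ) : HoldsVec (writeVec f s) s :=
  fun i => dif_pos i.2

theorem holdsMat_writeMat (f : ℕ → ℝ) (Y : Matrix (Fin m) (Fin n) ℝ) :
    HoldsMat (writeMat f Y) Y := by
  intro i j
  have hindex : i * n + j = (finProdFinEquiv (i, j) : ℕ) := by
    simp [finProdFinEquiv, mul_comm, add_comm]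
  rw [writeMat, hindex, holdsVec_writeVec, Equiv.symm_apply_apply]

theorem Runs.svd {Q : State → Prop} {m' n' r' a u s v : ℕ} (hm : st.nat m' = m)
    (hn : st.nat n' = n) (hY : HoldsMat (st.arr a) Y) (h : Q (st.setFactors (O m n Y) r' u s v)) :
    Runs O (.svd m' n' r' a u s v) st (min (n ^ 2 * m) (m ^ 2 * n) + 1) Q := by
  subst hm hn
  rw [← hY.readMat_eq] at h
  exact ⟨_, _, .svd _ _ _ _ _ _ _ _, le_rfl, h⟩

theorem SolvesVec.runs (hP : SolvesVec α P T) (O : Routine) (hδ : 0 ≤ δ) (hη : 0 ≤ η)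
    (h : HoldsInstance st δ η s) :
    Runs O P st (T r) fun st' => ∃ t, HoldsVec (st'.arr 1) t ∧ IsVecSol α δ η s t := by
  obtain ⟨t, st', x, hexec, ht, hx, hsol⟩ :=
    hP.2 O r s δ η hδ hη st h.dim h.weight h.bound h.vec
  exact ⟨t, st', hexec, ht, x, hx, hsol⟩

/-- The memory contains an instance of the matrix problem, in the format of `SolvesMat`. -/
structure HoldsMatInstance (st : State) (δ η : ℝ) (Y : Matrix (Fin m) (Fin n) ℝ) : Prop where
  rows : st.nat 0 = m
  cols : st.nat 1 = n
  weight : st.real 0 = δ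
  bound : st.real 1 = η
  mat : HoldsMat (st.arr 0) Y

/-- The orthonormal factors, stored beyond the memory with addresses below `K`, which belongs to a
program for the vector problem. The addresses from `K + 5` on are used for counters and offsets. -/
structure HoldsFactors (K : ℕ) (st : State) (U : Matrix (Fin m) (Fin r) ℝ)
    (V : Matrix (Fin n) (Fin r) ℝ) : Prop where
  rows : st.nat (K + 2) = m
  cols : st.nat (K + 3) = n
  rank : st.nat (K + 4) = r
  left : HoldsMat (st.arr (K + 2)) U
  right : HoldsMat (st.arr (K + 3)) V

theorem HoldsFactors.of_frame (h : HoldsFactors K st U V) (hf : Frame c st st')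
    (hnat : ∀ i ∈ [K + 2, K + 3, K + 4], i ∉ c.natWrites)
    (harr : ∀ a ∈ [K + 2, K + 3], a ∉ c.arrWrites) : HoldsFactors K st' U V where
  rows := (hf.nat _ (hnat _ (by simp))).trans h.rows
  cols := (hf.nat _ (hnat _ (by simp))).trans h.cols
  rank := (hf.nat _ (hnat _ (by simp))).trans h.rank
  left := (hf.arr (K + 2) (harr _ (by simp))).symm ▸ h.left
  right := (hf.arr (K + 3) (harr _ (by simp))).symm ▸ h.right

/-- The factors of a product `U diag(s) Vᵀ` are stored, the coefficients in the array `K + 4`. -/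
structure HoldsProduct (K : ℕ) (st : State) (U : Matrix (Fin m) (Fin r) ℝ) (s : Fin r → ℝ)
    (V : Matrix (Fin n) (Fin r) ℝ) : Prop extends HoldsFactors K st U V where
  coeff : HoldsVec (st.arr (K + 4)) s

theorem HoldsProduct.setNat (h : HoldsProduct K st U s V) (l k : ℕ) :
    HoldsProduct K (st.setNat (K + 5 + l) k) U s V where
  rows := by rw [State.setNat_nat, if_neg (by lia), h.rows]
  cols := by rw [State.setNat_nat, if_neg (by lia), h.cols]
  rank := by rw [State.setNat_nat, if_neg (by lia), h.rank]
  left := h.left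
  right := h.right
  coeff := h.coeff

theorem HoldsProduct.of_frame (h : HoldsProduct K st U s V) (hf : Frame c st st')
    (hnat : ∀ i ∈ [K + 2, K + 3, K + 4], i ∉ c.natWrites)
    (harr : ∀ a ∈ [K + 2, K + 3, K + 4], a ∉ c.arrWrites) : HoldsProduct K st' U s V where
  toHoldsFactors := h.toHoldsFactors.of_frame hf hnat fun _ ha =>
    harr _ (List.mem_append_left [K + 4] ha)
  coeff := (hf.arr (K + 4) (harr _ (by simp))).symm ▸ h.coeff

/-- Compute an SVD and set up the vector problem for the singular values. -/
def prepProg (K : ℕ) : Cmd :=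
  .seq (.setNat (K + 2) (.reg 0)) <| .seq (.setNat (K + 3) (.reg 1)) <|
  .seq (.svd (K + 2) (K + 3) (K + 4) 0 (K + 2) 0 (K + 3)) <| .setNat 0 (.reg (K + 4))

/-- Copy the solution of the vector problem to the array `K + 4`. -/
def copyProg (K : ℕ) : Cmd :=
  forLoop (K + 5) (K + 4) (.put (K + 4) (.reg (K + 5)) (.get 1 (.reg (K + 5))))

/-- Compute one entry of `U diag(s) Vᵀ` in the real register `K + 2`. The rows of `U` and `V` start
at the addresses in the registers `K + 8` and `K + 9`. -/
def entryProg (K : ℕ) : Cmd :=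
  .seq (.setReal (K + 2) (.const 0)) <| forLoop (K + 7) (K + 4) <|
  .setReal (K + 2) (.add (.reg (K + 2))
    (.mul (.mul (.get (K + 2) (.add (.reg (K + 8)) (.reg (K + 7)))) (.get (K + 4) (.reg (K + 7))))
      (.get (K + 3) (.add (.reg (K + 9)) (.reg (K + 7))))))

/-- Compute one entry of `U diag(s) Vᵀ` in the row of the array `1` that starts at the address in
register `K + 10`, and pass to the next row of `V`. -/
def cellProg (K : ℕ) : Cmd :=
  .seq (entryProg K) <| .seq (.put 1 (.add (.reg (K + 10)) (.reg (K + 6))) (.reg (K + 2))) <|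
  .setNat (K + 9) (.add (.reg (K + 9)) (.reg (K + 4)))

/-- Compute one row of `U diag(s) Vᵀ`. -/
def rowProg (K : ℕ) : Cmd :=
  .seq (.setNat (K + 9) (.const 0)) (forLoop (K + 6) (K + 3) (cellProg K))

/-- Compute `U diag(s) Vᵀ` in the array `1`. -/
def mulProg (K : ℕ) : Cmd :=
  .seq (.setNat (K + 8) (.const 0)) <| .seq (.setNat (K + 10) (.const 0)) <|
  forLoop (K + 5) (K + 2) <| .seq (rowProg K) <|
  .seq (.setNat (K + 8) (.add (.reg (K + 8)) (.reg (K + 4))))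
    (.setNat (K + 10) (.add (.reg (K + 10)) (.reg (K + 3))))

/-- The matrix program built from a program `P` for the vector problem. -/
def matProg (P : Cmd) (K : ℕ) : Cmd :=
  .seq (prepProg K) <| .seq P <| .seq (copyProg K) (mulProg K)

theorem runs_prepProg (h : HoldsMatInstance st δ η Y) :
    Runs O (prepProg K) st (min (n ^ 2 * m) (m ^ 2 * n) + 10) fun st' =>
      HoldsInstance st' δ η (O m n Y).σ ∧ HoldsFactors K st' (O m n Y).U (O m n Y).V := by
  refine Runs.of_le (Runs.seq_setNat <| Runs.seq_setNat <|
    (Runs.svd (Y := Y) (Q := Eq _) ?_ ?_ (by exact h.mat) rfl).seq fun st₁ _ hst₁ =>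
      Runs.setNat ?_) ?_
  · simp [NExp.val, h.rows]
  · simp [NExp.val, h.cols]
  · subst hst₁
    have hvec := holdsVec_writeVec (st.arr 0) (O m n Y).σ
    have hleft := holdsMat_writeMat (st.arr (K + 2)) (O m n Y).U
    have hright := holdsMat_writeMat (st.arr (K + 3)) (O m n Y).V
    constructor <;> constructor <;>
      simp [State.setFactors, NExp.val, h.rows, h.cols, h.weight, h.bound, hvec, hleft, hright]
  · simp only [NExp.cost]
    lia

theorem runs_copyProg (hr : st.nat (K + 4) = r) (hs : HoldsVec (st.arr 1) s) :
    Runs O (copyProg K) st (20 * r + 5) fun st' => HoldsVec (st'.arr (K + 4)) s := by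
  have hfill := Runs.forLoop_put (O := O) (st := st) (i := K + 5) (n := K + 4) (a := K + 4)
    (ix := .reg (K + 5)) (e := .get 1 (.reg (K + 5))) id (st.arr 1) Function.injective_id hr
    (by simp) fun k st₁ hf _ hk => ⟨hk, ?_⟩
  · refine (hfill.imp fun st' _ hst' i => ?_).of_le ?_
    · exact (hst' i i.2).trans (hs i)
    · simp only [NExp.cost, RExp.cost]
      lia
  · simp only [RExp.val, NExp.val, hk, hf.arr 1 (by simp [forLoop, Cmd.arrWrites])]

theorem runs_entryProg (h : HoldsProduct K st U s V)
    {i : Fin m} {j : Fin n} (hi : st.nat (K + 8) = i * r) (hj : st.nat (K + 9) = j * r) :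
    Runs O (entryProg K) st (30 * r + 10) fun st' =>
      st'.real (K + 2) = (U * Matrix.diagonal s * Vᵀ) i j := by
  have hsum := Runs.forLoop_setReal_add (O := O) (st := st.setReal (K + 2) 0) (i := K + 7)
    (n := K + 4) (x := K + 2) (e := .mul (.mul (.get (K + 2) (.add (.reg (K + 8)) (.reg (K + 7))))
      (.get (K + 4) (.reg (K + 7)))) (.get (K + 3) (.add (.reg (K + 9)) (.reg (K + 7)))))
    (fun k => st.arr (K + 2) (i * r + k) * st.arr (K + 4) k * st.arr (K + 3) (j * r + k)) h.rank
    (by simp) fun k st₁ hf _ hk => ?_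
  · refine Runs.of_le (Runs.seq_setReal <| Runs.imp (by simpa [RExp.val] using hsum)
      fun st' _ hst' => ?_) ?_
    · rw [hst', Finset.sum_range, Matrix.mul_apply]
      simp only [h.left i _, h.right j _, h.coeff _, Matrix.mul_diagonal, Matrix.transpose_apply]
    · simp only [NExp.cost, RExp.cost]
      lia
  · have hnat (l : ℕ) (hl : l ≠ K + 7) : st₁.nat l = st.nat l :=
      hf.nat l (by simpa [forLoop, Cmd.natWrites] using hl)
    have harr (a : ℕ) : st₁.arr a = st.arr a := hf.arr a (by simp [forLoop, Cmd.arrWrites])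
    simp [RExp.val, NExp.val, hk, harr, hnat, hi, hj]

theorem runs_cellProg (h : HoldsProduct K st U s V)
    {i : Fin m} {j : Fin n} {o : ℕ} (hi : st.nat (K + 8) = i * r) (hj : st.nat (K + 9) = j * r)
    (hcol : st.nat (K + 6) = j) (ho : st.nat (K + 10) = o) :
    Runs O (cellProg K) st (30 * r + 20) fun st' => st'.nat (K + 9) = (j + 1) * r ∧
      st'.arr 1 = Function.update (st.arr 1) (o + j) ((U * Matrix.diagonal s * Vᵀ) i j) := by
  refine Runs.of_le ((runs_entryProg h hi hj).seq fun st₁ hf hentry =>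
    Runs.seq_put <| Runs.setNat ?_) ?_
  · have hnat (l : ℕ) (hl : l ≠ K + 7) : st₁.nat l = st.nat l :=
      hf.nat l (by simpa [entryProg, forLoop, Cmd.natWrites] using hl)
    have harr : st₁.arr = st.arr := funext fun a =>
      hf.arr a (by simp [entryProg, forLoop, Cmd.arrWrites])
    simp [NExp.val, RExp.val, hnat, harr, hentry, h.rank, hj, hcol, ho, add_mul]
  · simp only [NExp.cost, RExp.cost]
    lia

theorem runs_rowProg (h : HoldsProduct K st U s V)
    {i : Fin m} {o : ℕ} (hi : st.nat (K + 8) = i * r) (ho : st.nat (K + 10) = o) :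
    Runs O (rowProg K) st (n * (30 * r + 40) + 10) fun st' =>
      (∀ j : Fin n, st'.arr 1 (o + j) = (U * Matrix.diagonal s * Vᵀ) i j) ∧
        ∀ t < o, st'.arr 1 t = st.arr 1 t := by
  refine Runs.of_le (Runs.seq_setNat <| (Runs.forLoop (N := n) (B := 30 * r + 20)
    (fun k st' => st'.nat (K + 9) = k * r ∧
      (∀ j : Fin n, j < k → st'.arr 1 (o + j) = (U * Matrix.diagonal s * Vᵀ) i j) ∧
        ∀ t < o, st'.arr 1 t = st.arr 1 t) ?_ ?_ ?_ ?_ ?_ ?_).imp ?_) ?_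
  · simpa using h.cols
  · simp
  · simp [cellProg, entryProg, forLoop, Cmd.natWrites]
  · simp [cellProg, entryProg, forLoop, Cmd.natWrites]
  · simp [NExp.val]
  · rintro k st₁ hf hk hcol ⟨hrow, hdone, hbelow⟩
    have hnat (l : ℕ) (hl : K + 7 < l) (hl' : l ≠ K + 9) : st₁.nat l = st.nat l := by
      rw [hf.nat l (by simp [cellProg, entryProg, forLoop, Cmd.natWrites]; lia),
        State.setNat_nat, if_neg hl']
    have hprod := (h.setNat 4 0).of_frame hf
      (by simp [cellProg, entryProg, forLoop, Cmd.natWrites])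
      (by simp [cellProg, entryProg, forLoop, Cmd.arrWrites])
    refine (runs_cellProg hprod (j := ⟨k, hk⟩) ((hnat _ (by lia) (by lia)).trans hi) hrow hcol
      ((hnat _ (by lia) (by lia)).trans ho)).imp fun st₂ _ ⟨hrow₂, harr₂⟩ =>
        ⟨by simpa using hrow₂, fun j hj => ?_, fun t ht => ?_⟩
    · obtain hjk | hjk := Nat.lt_succ_iff_lt_or_eq.1 hj
      · simp [harr₂, hjk.ne, hdone j hjk]
      · obtain rfl : j = ⟨k, hk⟩ := Fin.ext hjk
        simp [harr₂]
    · simp [harr₂, (ht.trans_le (Nat.le_add_right o k)).ne, hbelow t ht]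
  · exact fun st' _ ⟨_, hdone, hbelow⟩ => ⟨fun j => hdone j j.2, hbelow⟩
  · simp only [NExp.cost]
    lia

theorem runs_mulProg (h : HoldsProduct K st U s V) :
    Runs O (mulProg K) st (m * (n * (30 * r + 40) + 40) + 10) fun st' =>
      HoldsMat (st'.arr 1) (U * Matrix.diagonal s * Vᵀ) := by
  refine Runs.of_le (Runs.seq_setNat <| Runs.seq_setNat <|
    (Runs.forLoop (N := m) (B := n * (30 * r + 40) + 30)
      (fun k st' => st'.nat (K + 8) = k * r ∧ st'.nat (K + 10) = k * n ∧ ∀ i : Fin m, i < k →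
        ∀ j : Fin n, st'.arr 1 (i * n + j) = (U * Matrix.diagonal s * Vᵀ) i j)
      ?_ ?_ ?_ ?_ ?_ ?_).imp ?_) ?_
  · simpa using h.rows
  · simp
  · simp [rowProg, cellProg, entryProg, forLoop, Cmd.natWrites]
  · simp [rowProg, cellProg, entryProg, forLoop, Cmd.natWrites]
  · simp [NExp.val]
  · rintro k st₁ hf hk _ ⟨hleft, hout, hdone⟩
    have hprod := ((h.setNat 3 0).setNat 5 0).of_frame hf
      (by simp [rowProg, cellProg, entryProg, forLoop, Cmd.natWrites])
      (by simp [rowProg, cellProg, entryProg, forLoop, Cmd.arrWrites])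
    refine Runs.of_le ((runs_rowProg hprod (i := ⟨k, hk⟩) hleft hout).seq
      fun st₂ hf₂ ⟨hrow, hbelow⟩ => Runs.seq_setNat <| Runs.setNat ?_) ?_
    · have hnat (l : ℕ) (hl : l < K + 5 ∨ l = K + 8 ∨ l = K + 10) : st₂.nat l = st₁.nat l :=
        hf₂.nat l (by simp [rowProg, cellProg, entryProg, forLoop, Cmd.natWrites]; lia)
      refine ⟨?_, ?_, fun i hi j => ?_⟩
      · simp [NExp.val, hnat, hleft, hprod.rank, add_mul]
      · simp [NExp.val, hnat, hout, hprod.cols, add_mul]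
      · obtain hik | hik := Nat.lt_succ_iff_lt_or_eq.1 hi
        · have hlt : i * n + j < k * n := by nlinarith [j.2]
          exact (hbelow _ hlt).trans (hdone i hik j)
        · obtain rfl : i = ⟨k, hk⟩ := Fin.ext hik
          exact hrow j
    · simp only [NExp.cost]
      lia
  · exact fun st' _ ⟨_, _, hdone⟩ i j => hdone i i.2 j
  · simp only [NExp.cost]
    lia

theorem exists_writes_lt (c : Cmd) :
    ∃ K, (∀ i ∈ c.natWrites, i < K) ∧ ∀ a ∈ c.arrWrites, a < K :=
  ⟨c.natWrites.sum + c.arrWrites.sum + 1,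
    fun _ hi => Nat.lt_succ_of_le ((List.le_sum_of_mem hi).trans (Nat.le_add_right _ _)),
    fun _ ha => Nat.lt_succ_of_le ((List.le_sum_of_mem ha).trans (Nat.le_add_left _ _))⟩

theorem runs_matProg (hα : 1 ≤ α) (hP : SolvesVec α P T) (hnat : ∀ i ∈ P.natWrites, i < K)
    (harr : ∀ a ∈ P.arrWrites, a < K) (hO : O.Correct) (hδ : 0 ≤ δ) (hη : 0 ≤ η)
    (h : HoldsMatInstance st δ η Y) :
    Runs O (matProg P K) st (min (n ^ 2 * m) (m ^ 2 * n) + T (O m n Y).r +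
        m * (n * (30 * (O m n Y).r + 40) + 40) + 20 * (O m n Y).r + 30) fun st' =>
      ∃ X, HoldsMat (st'.arr 1) X ∧ IsMatSol α δ η Y X := by
  have hnat' (i : ℕ) : K + i ∉ P.natWrites := fun hi => absurd (hnat _ hi) (by lia)
  have harr' (a : ℕ) : K + a ∉ P.arrWrites := fun ha => absurd (harr _ ha) (by lia)
  refine Runs.of_le ((runs_prepProg h).seq fun st₁ _ ⟨hinst, hfac₁⟩ =>
    (hP.runs O hδ hη hinst).seq fun st₂ hf₂ ⟨s, hs, hsol⟩ =>
      (?_ : Runs O (.seq (copyProg K) (mulProg K)) st₂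
        (20 * (O m n Y).r + 5 + (m * (n * (30 * (O m n Y).r + 40) + 40) + 10)) _)) ?_
  · have hfac₂ := hfac₁.of_frame hf₂ (by simp [hnat']) (by simp [harr'])
    refine (runs_copyProg hfac₂.rank hs).seq fun st₃ hf₃ hs₃ =>
      (runs_mulProg ⟨hfac₂.of_frame hf₃ ?_ ?_, hs₃⟩).imp
        fun st' _ hX => ⟨_, hX, hsol.isMatSol hα hδ (hO m n Y)⟩
    · simp [copyProg, forLoop, Cmd.natWrites]
    · simp [copyProg, forLoop, Cmd.arrWrites]
  · lia

theorem le_of_transpose_mul_eq_one (h : Uᵀ * U = 1) : r ≤ m := by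
  have hrank := Matrix.rank_mul_le_right Uᵀ U
  rw [h, Matrix.rank_one, Fintype.card_fin] at hrank
  exact hrank.trans (Matrix.rank_le_height U)

theorem mul_mul_le_min (hm : r ≤ m) (hn : r ≤ n) : m * n * r ≤ min (n ^ 2 * m) (m ^ 2 * n) := by
  refine le_min ?_ ?_
  · calc m * n * r ≤ m * n * n := by gcongr
      _ = n ^ 2 * m := by ring
  · calc m * n * r ≤ m * n * m := by gcongr
      _ = m ^ 2 * n := by ring

theorem exists_solvesMat (hα : 1 ≤ α) (hP : SolvesVec α P T) : ∃ (Q : Cmd) (C : ℕ),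
    SolvesMat α Q fun m n r => C * (min (n ^ 2 * m) (m ^ 2 * n) + T r) := by
  obtain ⟨K, hnat, harr⟩ := exists_writes_lt P
  refine ⟨matProg P K, 200, fun O hO m n Y δ η hm hn hδ hη st hrows hcols hweight hbound hY => ?_⟩
  obtain ⟨t, st', hexec, ht, X, hX, hsol⟩ :=
    runs_matProg hα hP hnat harr hO hδ hη ⟨hrows, hcols, hweight, hbound, hY⟩
  refine ⟨t, st', X, hexec, ht.trans ?_, hX, hsol⟩
  have hrank := mul_mul_le_min (le_of_transpose_mul_eq_one (hO m n Y).left_orthonormal)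
    (le_of_transpose_mul_eq_one (hO m n Y).right_orthonormal)
  have hone := mul_mul_le_min hm hn
  have hmn : m ≤ m * n := Nat.le_mul_of_pos_right m hn
  have hr : (O m n Y).r ≤ m * n :=
    (le_of_transpose_mul_eq_one (hO m n Y).left_orthonormal).trans hmn
  linarith

end RealRAM

theorem lemma3_general (α : ENNReal) (hα : 1 ≤ α) :
    (∀ (m n r : ℕ) (δ η : ℝ), 0 ≤ δ → 0 ≤ η →
      ∀ (Y : Matrix (Fin m) (Fin n) ℝ) (U : Matrix (Fin m) (Fin r) ℝ) (σ : Fin r → ℝ)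
        (V : Matrix (Fin n) (Fin r) ℝ), IsSVD Y U σ V →
        (∃! X : Matrix (Fin m) (Fin n) ℝ, IsMatSol α δ η Y X) ∧
        (∃! s : Fin r → ℝ, IsVecSol α δ η σ s) ∧
        ∀ (X : Matrix (Fin m) (Fin n) ℝ) (s : Fin r → ℝ),
          IsMatSol α δ η Y X → IsVecSol α δ η σ s →
            X = U * Matrix.diagonal s * V.transpose) ∧
    (∀ (P : RealRAM.Cmd) (T : ℕ → ℕ), RealRAM.SolvesVec α P T →
      ∃ (Q : RealRAM.Cmd) (C : ℕ),
        RealRAM.SolvesMat α Q fun m n r => C * (min (n ^ 2 * m) (m ^ 2 * n) + T r)) ∧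
    (α = 1 ∨ α = ⊤ →
      ∃ (P : RealRAM.Cmd) (T : ℕ → ℕ), RealRAM.SolvesVec α P T ∧
        Asymptotics.IsBigO Filter.atTop (fun p : ℕ => (T p : ℝ))
          (fun p : ℕ => (p : ℝ) * Real.log p)) ∧
    (α = 2 →
      ∃ (P : RealRAM.Cmd) (T : ℕ → ℕ), RealRAM.SolvesVec α P T ∧
        Asymptotics.IsBigO Filter.atTop (fun p : ℕ => (T p : ℝ)) (fun p : ℕ => (p : ℝ))) := by
  refine ⟨?_, fun P T hP => RealRAM.exists_solvesMat hα hP, ?_, ?_⟩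
  · intro m n r δ η hδ hη Y U σ V hY
    obtain ⟨s, hs⟩ := exists_isVecSol hα δ hη σ
    exact ⟨⟨_, hs.isMatSol hα hδ hY, fun X hX => hX.eq_mul_diagonal_mul hα hδ hY hs⟩,
      ⟨s, hs, fun t ht => ht.unique hα hδ hs⟩,
      fun X t hX ht => hX.eq_mul_diagonal_mul hα hδ hY ht⟩
  · rintro (rfl | rfl)
    · exact ⟨_, _, RealRAM.solvesVec_one, RealRAM.isBigO_logTime⟩
    · exact ⟨_, _, RealRAM.solvesVec_top, RealRAM.isBigO_logTime⟩
  · rintro rfl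
    exact ⟨_, _, RealRAM.solvesVec_two, RealRAM.isBigO_linear 30 100⟩

theorem lemma3 (α : ENNReal) (hα : α = 1 ∨ α = 2 ∨ α = ⊤) :
    -- the matrix problem and the vector problem have unique solutions, and `X* = U diag(s*) Vᵀ`
    (∀ (m n r : ℕ) (δ η : ℝ), 0 ≤ δ → 0 ≤ η →
      ∀ (Y : Matrix (Fin m) (Fin n) ℝ) (U : Matrix (Fin m) (Fin r) ℝ) (σ : Fin r → ℝ)
        (V : Matrix (Fin n) (Fin r) ℝ), IsSVD Y U σ V →
        (∃! X : Matrix (Fin m) (Fin n) ℝ, IsMatSol α δ η Y X) ∧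
        (∃! s : Fin r → ℝ, IsVecSol α δ η σ s) ∧
        ∀ (X : Matrix (Fin m) (Fin n) ℝ) (s : Fin r → ℝ),
          IsMatSol α δ η Y X → IsVecSol α δ η σ s →
            X = U * Matrix.diagonal s * V.transpose) ∧
    -- `X*` is computed in `O(min(n²m, m²n) + T(r))` steps from a solver of running time `T`
    (∀ (P : RealRAM.Cmd) (T : ℕ → ℕ), RealRAM.SolvesVec α P T →
      ∃ (Q : RealRAM.Cmd) (C : ℕ),
        RealRAM.SolvesMat α Q fun m n r => C * (min (n ^ 2 * m) (m ^ 2 * n) + T r)) ∧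
    -- running times of the vector problems
    (α = 1 ∨ α = ⊤ →
      ∃ (P : RealRAM.Cmd) (T : ℕ → ℕ), RealRAM.SolvesVec α P T ∧
        Asymptotics.IsBigO Filter.atTop (fun p : ℕ => (T p : ℝ))
          (fun p : ℕ => (p : ℝ) * Real.log p)) ∧
    (α = 2 →
      ∃ (P : RealRAM.Cmd) (T : ℕ → ℕ), RealRAM.SolvesVec α P T ∧
        Asymptotics.IsBigO Filter.atTop (fun p : ℕ => (T p : ℝ)) (fun p : ℕ => (p : ℝ))) :=
  lemma3_general α (by rcases hα with rfl | rfl | rfl <;> simp)
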